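/- Let $G=\mathrm{SL}(2,\mathbb{R})$, $\Gamma=\mathrm{SL}(2,\mathbb{Z})$, $\mathbb{T}=\mathbb{R}/\mathbb{Z}$ and $e(x)=\mathrm{e}^{2\pi \mathrm{i} x}$. For $f\in L^2(\mathbb{R})=L^2(\mathbb{R},\mathbb{C})$ and $\phi\in\mathbb{R}$ define $f_\phi\in L^2(\mathbb{R})$ by $f_\phi(w)=f(w)$ if $\phi\equiv 0 \bmod 2\pi$, $f_\phi(w)=f(-w)$ if $\phi\equiv\pi\bmod 2\pi$, and $$f_\phi(w)=|\sin\phi|^{-1/2}\int_{\mathbb{R}} e\!\left[\frac{\frac12(w^2+w'^2)\cos\phi-ww'}{\sin\phi}\right] f(w')\,dw'\qquad(\phi\not\equiv 0\bmod\pi),$$ where for $f\in L^2(\mathbb{R})$ the integral is understood as the $L^2$-extension (via the Fourier transform on $L^2(\mathbb{R})$) of the integral operator from $L^1\cap L^2$. For $\tau=u+\mathrm{i}v$ with $v>0$ and $\xi=(x,y)$ put $$\Theta_f(\tau,\phi;\xi)=v^{1/4}\sum_{n\in\mathbb{Z}} f_\phi\big((n-y)v^{1/2}\big)\,e\big(\tfrac12(n-y)^2u+nx\big),$$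 the series being taken in $L^2$ of the unit square $[0,1)^2\ni\xi$; $|\Theta_f(\tau,\phi;\cdot)|$ is $\mathbb{Z}^2$-periodic and is regarded as a function on $\mathbb{T}^2$. Write $\Theta_f(M;\xi)=\Theta_f(\tau,\phi;\xi)$ for $M\in G$ with Iwasawa decomposition $$M=\begin{pmatrix}1&u\\0&1\end{pmatrix}\begin{pmatrix}v^{1/2}&0\\0&v^{-1/2}\end{pmatrix}\begin{pmatrix}\cos\phi&-\sin\phi\\ \sin\phi&\cos\phi\end{pmatrix}.$$ Theorem. Let $f\in L^2(\mathbb{R})$ and let $F:\mathbb{C}\to\mathbb{R}$ be bounded and continuous. Then, for all $\tau$ and $\phi$, the series defining $\Theta_f(\tau,\phi;\cdot)$ converges unconditionally in $L^2([0,1)^2)$, and $$\nu_f[F](M)=\int_{\mathbb{T}^3}F\big(e(t)\,|\Theta_f(M;\xi)|\big)\,dt\,d\xi$$ depends only on the coset $\Gamma M$ and defines a bounded continuous function $\nu_f[F]:\Gamma\backslash G\to\mathbb{R}$. -/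

import Mathlib

open MeasureTheory
open scoped ENNReal MatrixGroups

noncomputable section

namespace ThetaSum

/-- `e(x) = exp(2πix)`. -/
def e (x : ℝ) : ℂ := Complex.exp (2 * Real.pi * x * Complex.I)

lemma norm_e (x : ℝ) : ‖e x‖ = 1 := by
  have h : (2 * Real.pi * x * Complex.I : ℂ) = ((2 * Real.pi * x : ℝ) : ℂ) * Complex.I := by
    push_cast; ring
  rw [e, h, Complex.norm_exp_ofReal_mul_I]

lemma e_add (x y : ℝ) : e (x + y) = e x * e y := by
  rw [e, e, e, ← Complex.exp_add]; congr 1; push_cast; ring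

lemma continuous_e : Continuous e := by
  unfold e; fun_prop

lemma memLp_e_mul {α : Type*} [TopologicalSpace α] [MeasurableSpace α] [OpensMeasurableSpace α]
    {μ : Measure α} {g : α → ℝ} (hg : Continuous g)
    {f : α → ℂ} (hf : MemLp f 2 μ) : MemLp (fun w => e (g w) * f w) 2 μ := by
  refine hf.of_le ?_ (Filter.Eventually.of_forall fun w => by simp [norm_e])
  have h : Measurable (fun w => e (g w)) := (continuous_e.comp hg).measurable
  exact h.aestronglyMeasurable.mul hf.1

lemma quasi_affine {a : ℝ} (ha : a ≠ 0) (b : ℝ) :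
    Measure.map (fun y : ℝ => a * y + b) volume = ENNReal.ofReal |a⁻¹| • volume := by
  have h : (fun y : ℝ => a * y + b) = (fun y => y + b) ∘ (fun y => a * y) := rfl
  rw [h, ← Measure.map_map (by fun_prop) (by fun_prop), Real.map_volume_mul_left ha,
    Measure.map_smul, map_add_right_eq_self]

lemma memLp_affine {f : ℝ → ℂ} (hf : MemLp f 2 volume) {a : ℝ} (ha : a ≠ 0) (b : ℝ) :
    MemLp (fun y => f (a * y + b)) 2 volume := by
  refine MemLp.comp_of_map (g := f) (f := fun y : ℝ => a * y + b) ?_ (by fun_prop)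
  rw [quasi_affine ha]
  exact hf.smul_measure ENNReal.ofReal_ne_top

/-- Multiplication of an `L²` function by the chirp `w ↦ e(½ c w²)`. -/
def chirp (c : ℝ) (f : Lp ℂ 2 (volume : Measure ℝ)) : Lp ℂ 2 (volume : Measure ℝ) :=
  (memLp_e_mul (g := fun w => (1 / 2) * c * w ^ 2) (by fun_prop) (Lp.memLp f)).toLp

open Classical in
/-- The function `f_φ` attached to `f ∈ L²(ℝ)` (a representative of its class).  For `φ ∉ πℤ` the
oscillatory integral `|sin φ|^{-1/2} ∫ e[(½(w²+w'²)cos φ - w w')/sin φ] f(w') dw'` is understood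
in the `L²` sense: the exponential is expanded as
`e(½ cot φ w²) · e(½ cot φ w'²) · e(-(w / sin φ) w')`
and the integral against `e(-(w / sin φ) w')` is the Fourier transform on `L²(ℝ)`.
See `rot_eq_integral` for the agreement with the integral when `f` is integrable. -/
def rot (φ : ℝ) (f : Lp ℂ 2 (volume : Measure ℝ)) : ℝ → ℂ :=
  if (φ : Real.Angle) = 0 then fun w => f w
  else if (φ : Real.Angle) = (Real.pi : ℝ) then fun w => f (-w)
  else fun w => ((|Real.sin φ| ^ (-(1 / 2) : ℝ) : ℝ) : ℂ) *
    (e ((1 / 2) * (Real.cos φ / Real.sin φ) * w ^ 2) *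
      (FourierTransform.fourier (chirp (Real.cos φ / Real.sin φ) f) :
        Lp ℂ 2 (volume : Measure ℝ)) (w / Real.sin φ))

lemma sin_ne_zero_iff (φ : ℝ) : Real.sin φ ≠ 0 ↔
    (φ : Real.Angle) ≠ 0 ∧ (φ : Real.Angle) ≠ (Real.pi : ℝ) := by
  rw [← Real.Angle.sin_coe, Ne, Real.Angle.sin_eq_zero_iff, not_or]

lemma memLp_rot (φ : ℝ) (f : Lp ℂ 2 (volume : Measure ℝ)) : MemLp (rot φ f) 2 volume := by
  unfold rot
  split_ifs with h0 h1
  · exact Lp.memLp f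
  · simpa using memLp_affine (Lp.memLp f) (a := -1) (by norm_num) 0
  · have hs : Real.sin φ ≠ 0 := (sin_ne_zero_iff φ).2 ⟨h0, h1⟩
    refine MemLp.const_mul (memLp_e_mul (by fun_prop) ?_) _
    have := memLp_affine (Lp.memLp (FourierTransform.fourier
      (chirp (Real.cos φ / Real.sin φ) f) : Lp ℂ 2 (volume : Measure ℝ))) (inv_ne_zero hs) 0
    simpa [div_eq_inv_mul] using this

/-- On integrable functions, the Fourier transform on `L²(ℝ)` is the Fourier integral. -/
lemma fourier_ae_eq (h : Lp ℂ 2 (volume : Measure ℝ)) (hi : Integrable h) :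
    (FourierTransform.fourier h : Lp ℂ 2 (volume : Measure ℝ)) =ᵐ[volume]
      fun w => ∫ w' : ℝ, e (-(w' * w)) * h w' := by
  have hF : (fun w => ∫ w' : ℝ, e (-(w' * w)) * h w') =
      FourierTransform.fourier (h : ℝ → ℂ) := by
    funext w
    rw [Real.fourier_eq']
    congr 1; funext w'
    simp only [e, smul_eq_mul]
    congr 2
    simp
    ring
  rw [hF]
  refine ae_eq_of_integral_contDiff_smul_eq
    ((Lp.memLp _).locallyIntegrable (by norm_num)) ?_ ?_
  · have : Continuous (FourierTransform.fourier (h : ℝ → ℂ)) :=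
      VectorFourier.fourierIntegral_continuous Real.continuous_fourierChar
        (by exact continuous_inner) hi
    exact this.locallyIntegrable
  · intro g hg hgs
    have hg' : ContDiff ℝ ((⊤ : ℕ∞) : WithTop ℕ∞) (fun x => (g x : ℂ)) := Complex.ofRealCLM.contDiff.comp hg
    have hgs' : HasCompactSupport (fun x => (g x : ℂ)) :=
      hgs.comp_left (g := fun x : ℝ => (x : ℂ)) Complex.ofReal_zero
    let G : SchwartzMap ℝ ℂ := hgs'.toSchwartzMap hg'
    have h1 := congrArg (fun T : TemperedDistribution ℝ ℂ => T G)
      (Lp.fourier_toTemperedDistribution_eq h)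
    simp only [TemperedDistribution.fourier_apply, Lp.toTemperedDistribution_apply] at h1
    have h2 := VectorFourier.integral_fourierIntegral_smul_eq_flip (L := innerₗ ℝ)
      (μ := volume) (ν := volume) (f := (G : ℝ → ℂ)) (g := (h : ℝ → ℂ))
      Real.continuous_fourierChar (by exact continuous_inner) G.integrable hi
    have h3 : ∀ x, G x = (g x : ℂ) := fun x => rfl
    simp only [flip_innerₗ, h3] at h2
    calc ∫ x, g x • (FourierTransform.fourier h : Lp ℂ 2 (volume : Measure ℝ)) x
        = ∫ x, G x • (FourierTransform.fourier h : Lp ℂ 2 (volume : Measure ℝ)) x := by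
          simp [h3]
      _ = ∫ x, (FourierTransform.fourier G) x • h x := h1.symm
      _ = _ := by
          rw [SchwartzMap.fourier_coe]
          exact h2.trans (by simp [Real.fourier_eq, VectorFourier.fourierIntegral])

/-- For integrable `f`, the function `f_φ` is given by the absolutely convergent integral. -/
lemma rot_eq_integral (φ : ℝ) (hφ : Real.sin φ ≠ 0) (f : Lp ℂ 2 (volume : Measure ℝ))
    (hf : Integrable f) :
    rot φ f =ᵐ[volume] fun w => ((|Real.sin φ| ^ (-(1 / 2) : ℝ) : ℝ) : ℂ) *
      ∫ w' : ℝ, e (((1 / 2) * (w ^ 2 + w' ^ 2) * Real.cos φ - w * w') / Real.sin φ) * f w' := by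
  obtain ⟨h0, h1⟩ := (sin_ne_zero_iff φ).1 hφ
  set c := Real.cos φ / Real.sin φ with hc
  have hch : chirp c f =ᵐ[volume] fun w => e ((1 / 2) * c * w ^ 2) * f w := MemLp.coeFn_toLp _
  have hci : Integrable (chirp c f) := by
    refine Integrable.congr (hf.mono ?_ (Filter.Eventually.of_forall fun w => ?_)) hch.symm
    · exact (memLp_e_mul (by fun_prop) (Lp.memLp f)).1
    · simp [norm_e]
  have hF := fourier_ae_eq (chirp c f) hci
  have hq : Measure.QuasiMeasurePreserving (fun w : ℝ => w / Real.sin φ) volume volume := by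
    refine ⟨by fun_prop, ?_⟩
    have := quasi_affine (inv_ne_zero hφ) 0
    simp only [add_zero, ← div_eq_inv_mul] at this
    rw [this]
    exact Measure.smul_absolutelyContinuous
  filter_upwards [hq.ae hF] with w hw
  simp only [rot, if_neg h0, if_neg h1]
  rw [← hc, hw, ← integral_const_mul]
  congr 1
  refine integral_congr_ae ?_
  filter_upwards [hch] with w' hw'
  rw [hw', ← mul_assoc, ← mul_assoc, ← e_add, ← e_add]
  congr 2
  rw [hc]
  field_simp
  ring

/-- The `n`-th term of the theta series, as a function of `ξ = (x, y)`. -/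
def termFun (f : Lp ℂ 2 (volume : Measure ℝ)) (τ : UpperHalfPlane) (φ : ℝ) (n : ℤ)
    (ξ : ℝ × ℝ) : ℂ :=
  ((τ.im ^ (1 / 4 : ℝ) : ℝ) : ℂ) *
    (e ((1 / 2) * ((n : ℝ) - ξ.2) ^ 2 * τ.re + n * ξ.1) *
      rot φ f (((n : ℝ) - ξ.2) * τ.im ^ (1 / 2 : ℝ)))

/-- Lebesgue measure on `𝕋 = ℝ/ℤ`, realised on the fundamental domain `[0,1)`. -/
def torus1 : Measure ℝ := volume.restrict (Set.Ico 0 1)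

instance : IsProbabilityMeasure torus1 := ⟨by simp [torus1]⟩

/-- Lebesgue measure on `𝕋²`, realised on the fundamental domain `[0,1)²`.  (The theta series is
1-periodic in `x`, and `y ↦ y + 1` multiplies it by `e(x)`, so `|Θ_f|` is `ℤ²`-periodic.) -/
def torus2 : Measure (ℝ × ℝ) := torus1.prod torus1

/-- Lebesgue measure on `𝕋³`, realised on the fundamental domain `[0,1)³`. -/
def torus3 : Measure (ℝ × (ℝ × ℝ)) := torus1.prod torus2

lemma memLp_termFun (f : Lp ℂ 2 (volume : Measure ℝ)) (τ : UpperHalfPlane) (φ : ℝ) (n : ℤ) :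
    MemLp (termFun f τ φ n) 2 torus2 := by
  unfold termFun
  refine MemLp.const_mul (memLp_e_mul (by fun_prop) ?_) _
  have hv : -(τ.im ^ (1 / 2 : ℝ)) ≠ 0 := neg_ne_zero.2 (Real.rpow_pos_of_pos τ.im_pos _).ne'
  have h := (memLp_affine (memLp_rot φ f) hv (n * τ.im ^ (1 / 2 : ℝ))).restrict (Set.Ico 0 1)
  have h2 := h.comp_snd torus1
  refine (memLp_congr_ae (Filter.Eventually.of_forall fun p => ?_)).1 h2
  exact congrArg (rot φ f) (by ring)

/-- The `n`-th term of the theta series as an element of `L²([0,1)²)`. -/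
def term (f : Lp ℂ 2 (volume : Measure ℝ)) (τ : UpperHalfPlane) (φ : ℝ) (n : ℤ) :
    Lp ℂ 2 torus2 :=
  (memLp_termFun f τ φ n).toLp

/-- The theta function `Θ_f(τ, φ; ·)` for `f ∈ L²(ℝ)`: the unconditional sum of the theta series in
`L²([0,1)²)`. -/
def Theta (f : Lp ℂ 2 (volume : Measure ℝ)) (τ : UpperHalfPlane) (φ : ℝ) : Lp ℂ 2 torus2 :=
  ∑' n : ℤ, term f τ φ n

/-- First Iwasawa coordinate `τ = u + iv` of `M ∈ SL(2,ℝ)`. -/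
def tau (M : SL(2, ℝ)) : UpperHalfPlane := M • UpperHalfPlane.I

/-- Second Iwasawa coordinate `φ` of `M ∈ SL(2,ℝ)` (only its class modulo `2π` matters). -/
def phi (M : SL(2, ℝ)) : ℝ := Complex.arg ((M 1 0 : ℝ) * Complex.I + (M 1 1 : ℝ))

lemma iwasawa (M : SL(2, ℝ)) : (M : Matrix (Fin 2) (Fin 2) ℝ) =
    !![1, (tau M).re; 0, 1] *
    !![(tau M).im ^ (1 / 2 : ℝ), 0; 0, (tau M).im ^ (-(1 / 2) : ℝ)] *
    !![Real.cos (phi M), -Real.sin (phi M); Real.sin (phi M), Real.cos (phi M)] := by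
  set c : ℝ := M 1 0 with hc
  set d : ℝ := M 1 1 with hd
  have hdet : M 0 0 * d - M 0 1 * c = 1 := by
    have := M.det_coe
    rwa [Matrix.det_fin_two] at this
  have hpos : 0 < c ^ 2 + d ^ 2 := by
    rcases eq_or_ne c 0 with h | h
    · rcases eq_or_ne d 0 with h' | h'
      · simp [h, h'] at hdet
      · positivity
    · positivity
  set r : ℝ := Real.sqrt (c ^ 2 + d ^ 2) with hr
  have hrpos : 0 < r := Real.sqrt_pos.2 hpos
  have hr2 : r ^ 2 = c ^ 2 + d ^ 2 := Real.sq_sqrt hpos.le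
  set z : ℂ := (c : ℝ) * Complex.I + (d : ℝ) with hz
  have hzn : ‖z‖ = r := by
    rw [Complex.norm_eq_sqrt_sq_add_sq, hr]; congr 1; simp [hz]; ring
  have hz0 : z ≠ 0 := by rw [← norm_pos_iff, hzn]; exact hrpos
  have hcos : Real.cos (phi M) = d / r := by
    rw [phi, Complex.cos_arg hz0, hzn]; simp [hz]
  have hsin : Real.sin (phi M) = c / r := by
    rw [phi, Complex.sin_arg, ← hc, ← hd, ← hz, hzn]; simp [hz]
  have htau : ((tau M : UpperHalfPlane) : ℂ) =
      ((M 0 0 : ℝ) * Complex.I + (M 0 1 : ℝ)) / z := by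
    rw [tau, UpperHalfPlane.specialLinearGroup_apply]; simp [hz, hc, hd]
  have him : (tau M).im = (r ^ 2)⁻¹ := by
    rw [← UpperHalfPlane.coe_im, htau, Complex.div_im, Complex.normSq_eq_norm_sq, hzn]
    simp [hz]; field_simp; linarith
  have hre : (tau M).re = (M 0 0 * c + M 0 1 * d) / r ^ 2 := by
    rw [← UpperHalfPlane.coe_re, htau, Complex.div_re, Complex.normSq_eq_norm_sq, hzn]
    simp [hz]; field_simp; ring
  have hv1 : (tau M).im ^ (1 / 2 : ℝ) = r⁻¹ := by
    rw [him, ← Real.sqrt_eq_rpow, Real.sqrt_inv, Real.sqrt_sq hrpos.le]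
  have hv2 : (tau M).im ^ (-(1 / 2) : ℝ) = r := by
    rw [Real.rpow_neg (tau M).im_pos.le, hv1, inv_inv]
  rw [hv1, hv2, hre, hcos, hsin]
  ext i j
  fin_cases i <;> fin_cases j <;> simp [Matrix.mul_apply, Fin.sum_univ_two]
  all_goals field_simp
  all_goals try rw [hr2]
  · linear_combination d * hdet
  · linear_combination (-c) * hdet
  · exact hc.symm
  · exact hd.symm

/-- `M ↦ ∫_{𝕋³} F(e(t)|Θ_f(M; ξ)|) dt dξ` as a function on `SL(2,ℝ)`. -/
def nu (f : Lp ℂ 2 (volume : Measure ℝ)) (F : ℂ → ℝ) (M : SL(2, ℝ)) : ℝ :=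
  ∫ p, F (e p.1 * (‖Theta f (tau M) (phi M) p.2‖ : ℝ)) ∂torus3

/-- `Γ = SL(2,ℤ)` as a subgroup of `SL(2,ℝ)`. -/
def Gam : Subgroup SL(2, ℝ) :=
  (Matrix.SpecialLinearGroup.map (n := Fin 2) (Int.castRingHom ℝ)).range

/-- The space `Γ\G` of cosets `ΓM`, with the quotient topology. -/
abbrev Quo : Type := Quotient (QuotientGroup.rightRel Gam)

end ThetaSum

end

open Filter Topology
open scoped FourierTransform SchwartzMap

noncomputable section

namespace ThetaSum


/-! The theta function factors as `Theta f τ φ = zak (iwasawaOp τ φ f)`. Here `zak` is the Zak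
transform `g ↦ ∑ₙ e(n x) g(n - y)`, and `iwasawaOp`, in the Iwasawa coordinates of `M`, is the
isometry `metaOp M` of the metaplectic representation, up to a phase. The terms of the Zak series
are mutually orthogonal, because the characters `e(n x)` are, and their squared norms add up to
`‖g‖²`, because the intervals `(n - 1, n]` tile the line. This gives unconditional convergence and
makes `zak` an isometry (`summable_zakTerm`, `norm_tsum_zakTerm`).

Invariance need only be checked on the generators `S` and `T`. Left multiplication of `M` by `T`
applies the chirp `e(½ w²)` to `metaOp M f`, and left multiplication by `S` applies the Fourier
transform up to a unit scalar (`metaOp_TR_mul`, `fourierL_metaOp`). After `zak`, the chirp becomes a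
shear of the torus and the Fourier transform becomes, by Poisson summation, a quarter turn, each up
to a unimodular factor (`zak_chirpL_one`, `zak_eq_zak_fourierL`). The absolute value removes the
factor, and the integral does not see a measure-preserving map.

For continuity, when the lower-left entry `c` of `M` is nonzero, `metaOp M` is chirp, dilation,
Fourier transform and chirp with parameters rational in the entries, hence strongly continuous. The
average of `F` is continuous on `L²` by passing to almost everywhere convergent subsequences. Across
`c = 0` the phase of `metaOp M f` jumps, so continuity there is obtained from `S`-invariance, which
moves `M` to a matrix with nonzero lower-left entry. -/

/-- `L²(ℝ)`. -/
abbrev L2R : Type := Lp ℂ 2 (volume : Measure ℝ)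

/-! ### Phase multiplications, chirps and dilations as isometries of `L²` -/

/-- Multiplication by `e ∘ g` for a continuous real function `g`, as a linear isometry of `L²`. -/
def phaseMul {α : Type*} [TopologicalSpace α] [MeasurableSpace α] [OpensMeasurableSpace α]
    {μ : Measure α} (g : α → ℝ) (hg : Continuous g) : Lp ℂ 2 μ →ₗᵢ[ℂ] Lp ℂ 2 μ where
  toFun f := (memLp_e_mul hg (Lp.memLp f)).toLp
  map_add' f₁ f₂ := by
    refine Lp.ext ?_
    filter_upwards [MemLp.coeFn_toLp (memLp_e_mul hg (Lp.memLp (f₁ + f₂))), Lp.coeFn_add f₁ f₂,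
      Lp.coeFn_add (memLp_e_mul hg (Lp.memLp f₁)).toLp (memLp_e_mul hg (Lp.memLp f₂)).toLp,
      MemLp.coeFn_toLp (memLp_e_mul hg (Lp.memLp f₁)),
      MemLp.coeFn_toLp (memLp_e_mul hg (Lp.memLp f₂))] with x h₁ h₂ h₃ h₄ h₅
    rw [h₁, h₂, h₃, Pi.add_apply, Pi.add_apply, h₄, h₅, mul_add]
  map_smul' c f := by
    refine Lp.ext ?_
    filter_upwards [MemLp.coeFn_toLp (memLp_e_mul hg (Lp.memLp (c • f))), Lp.coeFn_smul c f,
      Lp.coeFn_smul c (memLp_e_mul hg (Lp.memLp f)).toLp,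
      MemLp.coeFn_toLp (memLp_e_mul hg (Lp.memLp f))] with x h₁ h₂ h₃ h₄
    simp only [RingHom.id_apply]
    rw [h₁, h₂, h₃, Pi.smul_apply, Pi.smul_apply, h₄, smul_eq_mul, smul_eq_mul, mul_left_comm]
  norm_map' f := by
    change ‖(memLp_e_mul hg (Lp.memLp f)).toLp‖ = ‖f‖
    rw [Lp.norm_toLp, Lp.norm_def]
    congr 1
    exact eLpNorm_congr_norm_ae (Eventually.of_forall fun x => by simp [norm_e])

lemma coeFn_phaseMul {α : Type*} [TopologicalSpace α] [MeasurableSpace α] [OpensMeasurableSpace α]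
    {μ : Measure α} (g : α → ℝ) (hg : Continuous g) (f : Lp ℂ 2 μ) :
    phaseMul g hg f =ᵐ[μ] fun x => e (g x) * f x :=
  MemLp.coeFn_toLp (memLp_e_mul hg (Lp.memLp f))

/-- `chirp c` as a linear isometry. -/
def chirpL (c : ℝ) : L2R →ₗᵢ[ℂ] L2R := phaseMul (fun w => (1 / 2) * c * w ^ 2) (by fun_prop)

lemma coeFn_chirpL (c : ℝ) (f : L2R) :
    chirpL c f =ᵐ[volume] fun w => e ((1 / 2) * c * w ^ 2) * f w := coeFn_phaseMul _ _ f

lemma chirpL_chirpL (s t : ℝ) (f : L2R) : chirpL s (chirpL t f) = chirpL (s + t) f := by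
  refine Lp.ext ?_
  filter_upwards [coeFn_chirpL s (chirpL t f), coeFn_chirpL t f, coeFn_chirpL (s + t) f]
    with x h₁ h₂ h₃
  rw [h₁, h₂, h₃, ← mul_assoc, ← e_add]
  congr 2
  ring

lemma quasiMeasurePreserving_mul {t : ℝ} (ht : t ≠ 0) :
    Measure.QuasiMeasurePreserving (fun w : ℝ => t * w) volume volume := by
  refine ⟨by fun_prop, ?_⟩
  rw [Real.map_volume_mul_left ht]
  exact Measure.smul_absolutelyContinuous

lemma memLp_dilate {t : ℝ} (ht : t ≠ 0) {f : ℝ → ℂ} (hf : MemLp f 2 volume) :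
    MemLp (fun w => ((|t| ^ (1 / 2 : ℝ) : ℝ) : ℂ) * f (t * w)) 2 volume := by
  have := memLp_affine hf ht 0
  simp only [add_zero] at this
  exact this.const_mul _

/-- The unitary dilation `f ↦ |t|^{1/2} f(t ·)` of `L²(ℝ)`. -/
def dil (t : ℝ) (ht : t ≠ 0) : L2R →ₗᵢ[ℂ] L2R where
  toFun f := (memLp_dilate ht (Lp.memLp f)).toLp
  map_add' f₁ f₂ := by
    refine Lp.ext ?_
    filter_upwards [MemLp.coeFn_toLp (memLp_dilate ht (Lp.memLp (f₁ + f₂))),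
      (quasiMeasurePreserving_mul ht).ae (Lp.coeFn_add f₁ f₂),
      Lp.coeFn_add (memLp_dilate ht (Lp.memLp f₁)).toLp (memLp_dilate ht (Lp.memLp f₂)).toLp,
      MemLp.coeFn_toLp (memLp_dilate ht (Lp.memLp f₁)),
      MemLp.coeFn_toLp (memLp_dilate ht (Lp.memLp f₂))] with x h₁ h₂ h₃ h₄ h₅
    rw [h₁, h₂, h₃, Pi.add_apply, Pi.add_apply, h₄, h₅, mul_add]
  map_smul' c f := by
    refine Lp.ext ?_
    filter_upwards [MemLp.coeFn_toLp (memLp_dilate ht (Lp.memLp (c • f))),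
      (quasiMeasurePreserving_mul ht).ae (Lp.coeFn_smul c f),
      Lp.coeFn_smul c (memLp_dilate ht (Lp.memLp f)).toLp,
      MemLp.coeFn_toLp (memLp_dilate ht (Lp.memLp f))] with x h₁ h₂ h₃ h₄
    simp only [RingHom.id_apply]
    rw [h₁, h₂, h₃, Pi.smul_apply, Pi.smul_apply, h₄, smul_eq_mul, smul_eq_mul, mul_left_comm]
  norm_map' f := by
    change ‖(memLp_dilate ht (Lp.memLp f)).toLp‖ = ‖f‖
    rw [Lp.norm_toLp, Lp.norm_def]
    have h1 : eLpNorm (fun w => f (t * w)) 2 volume =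
        ENNReal.ofReal (|t⁻¹| ^ (1 / 2 : ℝ)) * eLpNorm f 2 volume := by
      have h := eLpNorm_map_measure (μ := volume) (f := fun w : ℝ => t * w) (g := f) (p := 2)
        (by rw [Real.map_volume_mul_left ht]; exact (Lp.memLp f).1.smul_measure _) (by fun_prop)
      rw [Real.map_volume_mul_left ht, eLpNorm_smul_measure_of_ne_top (by norm_num)] at h
      change _ = eLpNorm (fun w => f (t * w)) 2 volume at h
      rw [← h, smul_eq_mul, ENNReal.ofReal_rpow_of_nonneg (abs_nonneg _) (by norm_num)]
      norm_num
    have h2 : eLpNorm (fun w => ((|t| ^ (1 / 2 : ℝ) : ℝ) : ℂ) * f (t * w)) 2 volume =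
        ENNReal.ofReal (|t| ^ (1 / 2 : ℝ)) * eLpNorm (fun w => f (t * w)) 2 volume := by
      have := eLpNorm_const_smul ((|t| ^ (1 / 2 : ℝ) : ℝ) : ℂ) (fun w => f (t * w)) 2 volume
      rw [← ofReal_norm, Complex.norm_real, Real.norm_of_nonneg (by positivity)] at this
      exact this
    rw [h2, h1, ← mul_assoc, ← ENNReal.ofReal_mul (by positivity),
      ← Real.mul_rpow (by positivity) (by positivity), ← abs_mul, mul_inv_cancel₀ ht]
    simp

lemma coeFn_dil (t : ℝ) (ht : t ≠ 0) (f : L2R) :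
    dil t ht f =ᵐ[volume] fun w => ((|t| ^ (1 / 2 : ℝ) : ℝ) : ℂ) * f (t * w) :=
  MemLp.coeFn_toLp (memLp_dilate ht (Lp.memLp f))

lemma dil_dil (s t : ℝ) (hs : s ≠ 0) (ht : t ≠ 0) (f : L2R) :
    dil s hs (dil t ht f) = dil (t * s) (mul_ne_zero ht hs) f := by
  refine Lp.ext ?_
  filter_upwards [coeFn_dil s hs (dil t ht f),
    (quasiMeasurePreserving_mul hs).ae (coeFn_dil t ht f), coeFn_dil (t * s) (mul_ne_zero ht hs) f]
    with x h₁ h₂ h₃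
  rw [h₁, h₂, h₃, ← mul_assoc, ← mul_assoc, ← Complex.ofReal_mul,
    ← Real.mul_rpow (by positivity) (by positivity), ← abs_mul, mul_comm s t]

lemma dil_chirpL (s t : ℝ) (ht : t ≠ 0) (f : L2R) :
    dil t ht (chirpL s f) = chirpL (s * t ^ 2) (dil t ht f) := by
  refine Lp.ext ?_
  filter_upwards [coeFn_dil t ht (chirpL s f),
    (quasiMeasurePreserving_mul ht).ae (coeFn_chirpL s f), coeFn_dil t ht f,
    coeFn_chirpL (s * t ^ 2) (dil t ht f)] with x h₁ h₂ h₃ h₄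
  rw [h₁, h₂, h₄, h₃, mul_left_comm]
  congr 2
  ring

/-! ### Density of Schwartz functions and strong continuity -/

lemma schwartz_induction {p : L2R → Prop} (hp : IsClosed {f | p f})
    (h : ∀ g : 𝓢(ℝ, ℂ), p (g.toLp 2)) (f : L2R) : p f :=
  DenseRange.induction_on (p := p)
    (SchwartzMap.denseRange_toLpCLM (p := 2) (μ := volume) ENNReal.ofNat_ne_top) f hp h

lemma schwartz_decay (g : 𝓢(ℝ, ℂ)) : ∃ C : ℝ, 0 ≤ C ∧ ∀ x, ‖g x‖ ≤ C * (1 + x ^ 2)⁻¹ := by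
  refine ⟨2 ^ 2 * (Finset.Iic (2, 0)).sup (fun m => SchwartzMap.seminorm ℝ m.1 m.2) g,
    by positivity, fun x => ?_⟩
  have h := SchwartzMap.one_add_le_sup_seminorm_apply (𝕜 := ℝ) (m := (2, 0)) (k := 2) (n := 0)
    le_rfl le_rfl g x
  rw [norm_iteratedFDeriv_zero] at h
  rw [← div_eq_mul_inv, le_div_iff₀ (by positivity), mul_comm]
  refine le_trans (mul_le_mul_of_nonneg_right ?_ (norm_nonneg _)) h
  rw [Real.norm_eq_abs, add_sq, sq_abs]
  nlinarith [abs_nonneg x]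

/-- Dominated convergence applied to `‖F i - f‖²`, with dominating function `(‖G‖ + ‖f‖)²`, which is
integrable since `G` and `f` are in `L²`. -/
lemma tendsto_toLp_of_dominated {α ι : Type*} [MeasurableSpace α] {μ : Measure α} {l : Filter ι}
    [l.IsCountablyGenerated] {F : ι → α → ℂ} {f : α → ℂ} {G : α → ℝ}
    (hF : ∀ i, MemLp (F i) 2 μ) (hf : MemLp f 2 μ) (hG : MemLp G 2 μ)
    (hb : ∀ᶠ i in l, ∀ᵐ a ∂μ, ‖F i a‖ ≤ G a) (hl : ∀ᵐ a ∂μ, Tendsto (F · a) l (𝓝 (f a))) :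
    Tendsto (fun i => (hF i).toLp) l (𝓝 hf.toLp) := by
  rw [Lp.tendsto_Lp_iff_tendsto_eLpNorm'']
  have key : Tendsto (fun i => ∫⁻ a, ‖F i a - f a‖ₑ ^ (2 : ℝ) ∂μ) l (𝓝 (∫⁻ _, 0 ∂μ)) := by
    refine tendsto_lintegral_filter_of_dominated_convergence'
      (fun a => ‖‖G a‖ + ‖f a‖‖ₑ ^ (2 : ℝ)) ?_ ?_ ?_ ?_
    · exact Eventually.of_forall fun i => ((hF i).1.sub hf.1).enorm.pow_const _
    · filter_upwards [hb] with i hi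
      filter_upwards [hi] with a ha
      gcongr
      rw [enorm_le_iff_norm_le, Real.norm_of_nonneg (by positivity)]
      exact (norm_sub_le _ _).trans (add_le_add (ha.trans (le_abs_self _)) le_rfl)
    · have := (hG.norm.add hf.norm).2
      rw [eLpNorm_lt_top_iff_lintegral_rpow_enorm_lt_top (by norm_num) (by norm_num)] at this
      simpa using this.ne
    · filter_upwards [hl] with a ha
      have h1 : Tendsto (fun i => ‖F i a - f a‖ₑ) l (𝓝 0) := by
        have := (ha.sub_const (f a)).enorm
        simpa using this
      have h2 := (ENNReal.continuous_rpow_const (y := (2 : ℝ))).tendsto (0 : ℝ≥0∞)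
      rw [ENNReal.zero_rpow_of_pos (by norm_num)] at h2
      exact h2.comp h1
  rw [lintegral_zero] at key
  have h2 := (ENNReal.continuous_rpow_const (y := (1 / 2 : ℝ))).tendsto (0 : ℝ≥0∞)
  rw [ENNReal.zero_rpow_of_pos (by norm_num)] at h2
  refine (h2.comp key).congr fun i => ?_
  rw [eLpNorm_eq_lintegral_rpow_enorm_toReal (by norm_num) (by norm_num)]
  simp

lemma continuous_chirpL (f : L2R) : Continuous fun s => chirpL s f := by
  refine continuous_iff_continuousAt.2 fun s₀ => ?_
  refine tendsto_toLp_of_dominated (G := fun w => ‖f w‖)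
    (fun s => memLp_e_mul (g := fun w => (1 / 2) * s * w ^ 2) (by fun_prop) (Lp.memLp f))
    (memLp_e_mul (g := fun w => (1 / 2) * s₀ * w ^ 2) (by fun_prop) (Lp.memLp f))
    (Lp.memLp f).norm (Eventually.of_forall fun s => Eventually.of_forall fun w => ?_)
    (Eventually.of_forall fun w => ?_)
  · simp [norm_e]
  · have : Continuous fun s : ℝ => e ((1 / 2) * s * w ^ 2) * f w :=
      (continuous_e.comp (by fun_prop)).mul continuous_const
    exact this.tendsto s₀

/-- A strongly continuous family of linear isometries is jointly continuous. -/
lemma continuous_isometry_family {X E : Type*} [TopologicalSpace X] [NormedAddCommGroup E]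
    [NormedSpace ℂ E] {T : X → E →ₗᵢ[ℂ] E} (hT : ∀ f, Continuous fun x => T x f) {h : X → E}
    (hh : Continuous h) : Continuous fun x => T x (h x) := by
  refine continuous_iff_continuousAt.2 fun x₀ => ?_
  have h1 : Tendsto (fun x => T x (h x - h x₀)) (𝓝 x₀) (𝓝 0) := by
    rw [tendsto_zero_iff_norm_tendsto_zero]
    simp only [LinearIsometry.norm_map]
    have := (hh.tendsto x₀).sub_const (h x₀)
    simpa using this.norm
  have h2 := h1.add ((hT (h x₀)).tendsto x₀)
  simpa [ContinuousAt, ← map_add] using h2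

/-- Isometries do not increase distances, so approximating `f` by `g` approximates the orbit map of
`f` by that of `g` uniformly in `x`. This lets strong continuity be tested on a dense set. -/
lemma isClosed_continuous_isometry {X E : Type*} [TopologicalSpace X] [NormedAddCommGroup E]
    [NormedSpace ℂ E] (T : X → E →ₗᵢ[ℂ] E) : IsClosed {f | Continuous fun x => T x f} := by
  refine isClosed_of_closure_subset fun f hf => ?_
  refine continuous_of_uniform_approx_of_continuous fun u hu => ?_
  obtain ⟨ε, hε, hεu⟩ := Metric.mem_uniformity_dist.1 hu
  obtain ⟨g, hg, hfg⟩ := Metric.mem_closure_iff.1 hf ε hε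
  refine ⟨fun x => T x g, hg, fun x => hεu ?_⟩
  rwa [(T x).dist_map]

/-- Unlike for chirps, a general `f` gives no pointwise limit of `f (t * w)` as `t` varies; density
reduces to Schwartz functions, where decay supplies the dominating function. -/
lemma continuous_dil (f : L2R) : Continuous fun t : {t : ℝ // t ≠ 0} => dil t t.2 f := by
  refine schwartz_induction (p := fun f => Continuous fun t : {t : ℝ // t ≠ 0} => dil t t.2 f)
    (isClosed_continuous_isometry fun t : {t : ℝ // t ≠ 0} => dil t t.2) (fun g => ?_) f
  obtain ⟨C, hC0, hC⟩ := schwartz_decay g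
  refine continuous_iff_continuousAt.2 fun ⟨t₀, ht₀⟩ => ?_
  have hdil : ∀ t : {t : ℝ // t ≠ 0}, dil t t.2 (g.toLp 2) =
      (memLp_dilate t.2 (g.memLp 2 volume)).toLp := fun t => by
    refine Lp.ext ?_
    filter_upwards [coeFn_dil t t.2 (g.toLp 2), MemLp.coeFn_toLp
      (memLp_dilate t.2 (g.memLp 2 volume)),
      (quasiMeasurePreserving_mul t.2).ae (g.coeFn_toLp 2 volume)] with w h₁ h₂ h₃
    rw [h₁, h₂, h₃]
  simp only [ContinuousAt]
  rw [hdil ⟨t₀, ht₀⟩]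
  simp only [hdil]
  have hpos : 0 < |t₀| := abs_pos.2 ht₀
  set K : ℝ := (2 * |t₀|) ^ (1 / 2 : ℝ) * C with hK
  have hK0 : 0 ≤ K := by positivity
  have hint : Integrable (fun w : ℝ => (1 + (|t₀| / 2 * w) ^ 2)⁻¹) :=
    integrable_inv_one_add_sq.comp_mul_left' (by positivity)
  refine tendsto_toLp_of_dominated (G := fun w => K * (1 + (|t₀| / 2 * w) ^ 2)⁻¹)
    (fun t => memLp_dilate t.2 (g.memLp 2 volume)) (memLp_dilate ht₀ (g.memLp 2 volume)) ?_ ?_ ?_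
  · refine MemLp.const_mul ?_ K
    rw [memLp_two_iff_integrable_sq hint.1]
    refine hint.mono (hint.1.pow 2) (Eventually.of_forall fun w => ?_)
    have h1 : (1 + (|t₀| / 2 * w) ^ 2)⁻¹ ≤ 1 :=
      inv_le_one_of_one_le₀ (by nlinarith [sq_nonneg (|t₀| / 2 * w)])
    have h0 : 0 ≤ (1 + (|t₀| / 2 * w) ^ 2)⁻¹ := by positivity
    rw [Real.norm_of_nonneg (by positivity), Real.norm_of_nonneg h0]
    nlinarith
  -- For `t` near `t₀`, the bound `|t| < 2|t₀|` controls the factor `|t|^{1/2}`, and `|t| > |t₀|/2`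
  -- controls the decay of `g (t * w)`.
  · have hcont : Continuous fun t : {t : ℝ // t ≠ 0} => |(t : ℝ)| := by fun_prop
    have e1 : ∀ᶠ t : {t : ℝ // t ≠ 0} in 𝓝 ⟨t₀, ht₀⟩, |t₀| / 2 < |(t : ℝ)| :=
      hcont.continuousAt.eventually (lt_mem_nhds (by simpa using hpos))
    have e2 : ∀ᶠ t : {t : ℝ // t ≠ 0} in 𝓝 ⟨t₀, ht₀⟩, |(t : ℝ)| < 2 * |t₀| :=
      hcont.continuousAt.eventually (gt_mem_nhds (by simp; linarith))
    filter_upwards [e1, e2] with t h1 h2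
    refine Eventually.of_forall fun w => ?_
    rw [norm_mul, Complex.norm_real, Real.norm_of_nonneg (by positivity), hK, mul_assoc]
    refine mul_le_mul (Real.rpow_le_rpow (abs_nonneg _) h2.le (by norm_num)) ?_ (norm_nonneg _)
      (by positivity)
    refine (hC _).trans (mul_le_mul_of_nonneg_left ?_ hC0)
    refine inv_anti₀ (by positivity) ?_
    rw [mul_pow, mul_pow, ← sq_abs (t : ℝ)]
    gcongr
  · refine Eventually.of_forall fun w => ?_
    have : Continuous fun t : {t : ℝ // t ≠ 0} =>
        ((|(t : ℝ)| ^ (1 / 2 : ℝ) : ℝ) : ℂ) * g (t * w) := by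
      refine (Complex.continuous_ofReal.comp ?_).mul (g.continuous.comp (by fun_prop))
      exact (Real.continuous_rpow_const (by norm_num)).comp (by fun_prop)
    exact this.tendsto ⟨t₀, ht₀⟩


/-! ### The Fourier transform against dilations and chirps -/

/-- The Fourier transform of `L²(ℝ)` as a linear isometry. -/
def fourierL : L2R →ₗᵢ[ℂ] L2R := (Lp.fourierTransformₗᵢ ℝ ℂ).toLinearIsometry

lemma fourierL_apply (f : L2R) : fourierL f = FourierTransform.fourier f := rfl

lemma fourierL_toLp (g : 𝓢(ℝ, ℂ)) : fourierL (g.toLp 2) = (𝓕 g).toLp 2 := g.toLp_fourier_eq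

lemma coeFn_fourierL {f : L2R} (hf : Integrable f) {g : ℝ → ℂ} (hg : f =ᵐ[volume] g) :
    fourierL f =ᵐ[volume] fun w => ∫ x : ℝ, e (-(x * w)) * g x := by
  filter_upwards [fourier_ae_eq f hf] with w hw
  rw [fourierL_apply, hw]
  refine integral_congr_ae ?_
  filter_upwards [hg] with x hx
  rw [hx]

lemma fourierL_fourierL (f : L2R) : fourierL (fourierL f) = dil (-1) (by norm_num) f := by
  refine schwartz_induction (p := fun f => fourierL (fourierL f) = dil (-1) (by norm_num) f)
    (isClosed_eq (by fun_prop) (by fun_prop)) (fun g => ?_) f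
  rw [fourierL_toLp, fourierL_toLp]
  refine Lp.ext ?_
  filter_upwards [coeFn_dil (-1) (by norm_num) (g.toLp 2), (𝓕 (𝓕 g)).coeFn_toLp 2 volume,
    (quasiMeasurePreserving_mul (t := -1) (by norm_num)).ae (g.coeFn_toLp 2 volume)]
    with w h₁ h₂ h₃
  rw [h₁, h₂, h₃]
  have h := congrArg (fun G : 𝓢(ℝ, ℂ) => G (-w)) (show 𝓕⁻ (𝓕 g) = g from FourierTransform.fourierInv_fourier_eq g)
  simp only [SchwartzMap.fourierInv_coe, Real.fourierInv_eq_fourier_neg, neg_neg] at h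
  rw [SchwartzMap.fourier_coe, h]
  simp

lemma fourierL_dil (t : ℝ) (ht : t ≠ 0) (f : L2R) :
    fourierL (dil t ht f) = dil t⁻¹ (inv_ne_zero ht) (fourierL f) := by
  refine schwartz_induction
    (p := fun f => fourierL (dil t ht f) = dil t⁻¹ (inv_ne_zero ht) (fourierL f))
    (isClosed_eq (by fun_prop) (by fun_prop)) (fun g => ?_) f
  have hg := g.coeFn_toLp 2 volume
  have hd : dil t ht (g.toLp 2) =ᵐ[volume]
      fun w => ((|t| ^ (1 / 2 : ℝ) : ℝ) : ℂ) * g (t * w) := by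
    filter_upwards [coeFn_dil t ht (g.toLp 2), (quasiMeasurePreserving_mul ht).ae hg] with w h₁ h₂
    rw [h₁, h₂]
  have hdi : Integrable (dil t ht (g.toLp 2)) :=
    ((g.integrable.comp_mul_left' ht).const_mul _).congr hd.symm
  refine Lp.ext ?_
  filter_upwards [coeFn_fourierL hdi hd, coeFn_dil t⁻¹ (inv_ne_zero ht) (fourierL (g.toLp 2)),
    (quasiMeasurePreserving_mul (inv_ne_zero ht)).ae
      (coeFn_fourierL (g.integrable.congr hg.symm) hg)] with w h₁ h₂ h₃
  rw [h₁, h₂, h₃]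
  have h := Measure.integral_comp_mul_left (fun x : ℝ => e (-(x * (t⁻¹ * w))) * g x) t
  have h' : (fun x : ℝ => e (-(x * w)) * (((|t| ^ (1 / 2 : ℝ) : ℝ) : ℂ) * g (t * x))) =
      fun x => ((|t| ^ (1 / 2 : ℝ) : ℝ) : ℂ) * (e (-(t * x * (t⁻¹ * w))) * g (t * x)) := by
    funext x
    rw [mul_left_comm]
    congr 3
    field_simp
  rw [h', integral_const_mul, h, Complex.real_smul, ← mul_assoc, ← Complex.ofReal_mul]
  congr 2
  have hp : 0 < |t| := abs_pos.2 ht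
  rw [abs_inv, Real.inv_rpow hp.le, ← Real.rpow_neg_one |t|, ← Real.rpow_add hp,
    ← Real.rpow_neg hp.le]
  norm_num

lemma e_eq_cexp (x : ℝ) : e x = Complex.exp (2 * Real.pi * x * Complex.I) := rfl

/-- The Fourier transform of a Schwartz function against a Gaussian. -/
lemma integral_gaussian_mul_fourier (h : 𝓢(ℝ, ℂ)) {b : ℂ} (hb : 0 < b.re) (c : ℂ) :
    ∫ x : ℝ, Complex.exp (-Real.pi * b * x ^ 2 + 2 * Real.pi * c * x) * 𝓕 h x =
      ∫ x : ℝ, (1 / b ^ (1 / 2 : ℂ) *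
        Complex.exp (-Real.pi / b * (x + Complex.I * c) ^ 2)) * h x := by
  have hint : Integrable fun x : ℝ =>
      Complex.exp (-Real.pi * b * x ^ 2 + 2 * Real.pi * c * x) := by
    have := _root_.integrable_cexp_quadratic (b := Real.pi * b)
      (by simpa using mul_pos Real.pi_pos hb) (2 * Real.pi * c) 0
    simpa using this
  -- The multiplication formula moves the Fourier transform from `h` onto the Gaussian, where it is
  -- explicit.
  have h2 := VectorFourier.integral_fourierIntegral_smul_eq_flip (L := innerₗ ℝ)
    (μ := volume) (ν := volume)
    (f := fun x : ℝ => Complex.exp (-Real.pi * b * x ^ 2 + 2 * Real.pi * c * x)) (g := (h : ℝ → ℂ))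
    Real.continuous_fourierChar (by exact continuous_inner) hint h.integrable
  rw [flip_innerₗ] at h2
  have h3 := fourier_gaussian_pi' hb c
  have h4 : ∀ x, VectorFourier.fourierIntegral 𝐞 volume (innerₗ ℝ)
      (fun x : ℝ => Complex.exp (-Real.pi * b * x ^ 2 + 2 * Real.pi * c * x)) x =
      1 / b ^ (1 / 2 : ℂ) * Complex.exp (-Real.pi / b * (x + Complex.I * c) ^ 2) :=
    fun x => congrFun h3 x
  simp only [h4, smul_eq_mul] at h2
  exact h2.symm

/-- A chirp is a Gaussian with purely imaginary parameter `-is`. The identity holds for the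
integrable Gaussians with parameter `ε - is`, `ε > 0`, and passes to the limit `ε → 0⁺` by dominated
convergence on both sides. -/
lemma integral_chirp_mul_fourier (h : 𝓢(ℝ, ℂ)) {s : ℝ} (hs : s ≠ 0) (w : ℝ) :
    ∫ x : ℝ, e (-(x * w)) * (e ((1 / 2) * s * x ^ 2) * 𝓕 h x) =
      1 / (-(s * Complex.I) : ℂ) ^ (1 / 2 : ℂ) *
        (e ((1 / 2) * -s⁻¹ * w ^ 2) *
          ∫ x : ℝ, e (-(x * (s⁻¹ * w))) * (e ((1 / 2) * -s⁻¹ * x ^ 2) * h x)) := by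
  let b : ℝ → ℂ := fun ε => ε - s * Complex.I
  have hb : Continuous b := by fun_prop
  have hb0 : b 0 = -(s * Complex.I) := by simp [b]
  -- The imaginary part `-s` is nonzero, so the principal square root of `b ε` stays continuous up
  -- to `ε = 0`.
  have hbs : ∀ ε, b ε ∈ Complex.slitPlane := fun ε => by
    right; simp [b, hs]
  have hbn : ∀ ε, b ε ≠ 0 := fun ε => Complex.slitPlane_ne_zero (hbs ε)
  have hbp : Continuous fun ε => 1 / (b ε) ^ (1 / 2 : ℂ) :=
    continuous_const.div (hb.cpow continuous_const fun ε => hbs ε)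
      (fun ε => by simp [Complex.cpow_eq_zero_iff, hbn ε])
  have hL : Tendsto (fun ε : ℝ => ∫ x : ℝ,
      Complex.exp (-Real.pi * b ε * x ^ 2 + 2 * Real.pi * (-(w * Complex.I)) * x) * 𝓕 h x)
      (𝓝[>] 0) (𝓝 (∫ x : ℝ,
      Complex.exp (-Real.pi * b 0 * x ^ 2 + 2 * Real.pi * (-(w * Complex.I)) * x) * 𝓕 h x)) := by
    refine tendsto_integral_filter_of_dominated_convergence (fun x => ‖𝓕 h x‖) ?_ ?_ ?_ ?_
    · refine Eventually.of_forall fun ε => Continuous.aestronglyMeasurable ?_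
      exact Continuous.mul (by fun_prop) (𝓕 h).continuous
    · filter_upwards [self_mem_nhdsWithin] with ε hε
      refine Eventually.of_forall fun x => ?_
      rw [norm_mul, Complex.norm_exp]
      refine mul_le_of_le_one_left (norm_nonneg _) (Real.exp_le_one_iff.2 ?_)
      have : (-Real.pi * b ε * x ^ 2 + 2 * Real.pi * (-(w * Complex.I)) * x : ℂ).re =
          -(Real.pi * ε * x ^ 2) := by
        simp [b, pow_two]
      rw [this]
      have hε' : (0 : ℝ) < ε := hε
      have := Real.pi_pos
      rw [neg_nonpos]
      positivity
    · exact (𝓕 h).integrable.norm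
    · refine Eventually.of_forall fun x => ?_
      have : Continuous fun ε : ℝ =>
          Complex.exp (-Real.pi * b ε * x ^ 2 + 2 * Real.pi * (-(w * Complex.I)) * x) * 𝓕 h x := by
        fun_prop
      exact (this.tendsto 0).mono_left nhdsWithin_le_nhds
  have hR : Tendsto (fun ε : ℝ => ∫ x : ℝ, (1 / b ε ^ (1 / 2 : ℂ) *
        Complex.exp (-Real.pi / b ε * (x + Complex.I * (-(w * Complex.I))) ^ 2)) * h x)
      (𝓝[>] 0) (𝓝 (∫ x : ℝ, (1 / b 0 ^ (1 / 2 : ℂ) *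
        Complex.exp (-Real.pi / b 0 * (x + Complex.I * (-(w * Complex.I))) ^ 2)) * h x)) := by
    have hx : ∀ x : ℝ, (x + Complex.I * (-(w * Complex.I)) : ℂ) = ((x + w : ℝ) : ℂ) := fun x => by
      push_cast
      linear_combination (-(w : ℂ)) * Complex.I_sq
    simp only [hx]
    obtain ⟨C, hC⟩ : ∃ C, ∀ᶠ ε in 𝓝[>] (0 : ℝ), ‖1 / b ε ^ (1 / 2 : ℂ)‖ ≤ C := by
      refine ⟨‖1 / b 0 ^ (1 / 2 : ℂ)‖ + 1, ?_⟩
      refine Eventually.filter_mono nhdsWithin_le_nhds ?_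
      filter_upwards [(hbp.norm.continuousAt (x := 0)).eventually
        (gt_mem_nhds (lt_add_one _))] with ε hε using hε.le
    refine tendsto_integral_filter_of_dominated_convergence (fun x => C * ‖h x‖) ?_ ?_ ?_ ?_
    · refine Eventually.of_forall fun ε => Continuous.aestronglyMeasurable ?_
      exact Continuous.mul (by fun_prop) h.continuous
    · filter_upwards [self_mem_nhdsWithin, hC] with ε hε hCε
      refine Eventually.of_forall fun x => ?_
      rw [norm_mul, norm_mul, Complex.norm_exp]
      refine mul_le_mul_of_nonneg_right ?_ (norm_nonneg _)
      refine (mul_le_of_le_one_right (norm_nonneg _) (Real.exp_le_one_iff.2 ?_)).trans hCε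
      -- The real part of `1 / b ε` is `ε / |b ε|²`, so the transformed Gaussian also has modulus at
      -- most one.
      have : (-Real.pi / b ε * ((x + w : ℝ) : ℂ) ^ 2).re =
          -(Real.pi * (x + w) ^ 2 * (ε / Complex.normSq (b ε))) := by
        rw [← Complex.ofReal_pow, div_mul_eq_mul_div, ← Complex.ofReal_neg, ← Complex.ofReal_mul,
          Complex.div_re, Complex.ofReal_re, Complex.ofReal_im]
        simp only [b, Complex.sub_re, Complex.ofReal_re, Complex.mul_re, Complex.I_re, mul_zero,
          Complex.ofReal_im, Complex.I_im, zero_mul, sub_zero, zero_div, add_zero]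
        ring
      rw [this, neg_nonpos]
      have hε' : (0 : ℝ) < ε := hε
      have := Real.pi_pos
      have := Complex.normSq_nonneg (b ε)
      positivity
    · exact h.integrable.norm.const_mul C
    · refine Eventually.of_forall fun x => ?_
      have : Continuous fun ε : ℝ => (1 / b ε ^ (1 / 2 : ℂ) *
          Complex.exp (-Real.pi / b ε * ((x + w : ℝ) : ℂ) ^ 2)) * h x := by
        refine (hbp.mul (Complex.continuous_exp.comp
          ((continuous_const.div hb hbn).mul continuous_const))).mul continuous_const
      exact (this.tendsto 0).mono_left nhdsWithin_le_nhds
  have hEq := tendsto_nhds_unique (hL.congr' ?_) hR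
  · calc ∫ x : ℝ, e (-(x * w)) * (e ((1 / 2) * s * x ^ 2) * 𝓕 h x)
        = ∫ x : ℝ, Complex.exp (-Real.pi * b 0 * x ^ 2 + 2 * Real.pi * (-(w * Complex.I)) * x) *
            𝓕 h x := by
          congr 1
          funext x
          rw [← mul_assoc, e_eq_cexp, e_eq_cexp, ← Complex.exp_add, hb0]
          congr 2
          push_cast
          ring
      _ = _ := hEq
      _ = _ := by
          rw [hb0, ← integral_const_mul, ← integral_const_mul]
          congr 1
          funext x
          rw [mul_assoc]
          congr 1
          rw [← mul_assoc, ← mul_assoc, ← e_add, ← e_add, e_eq_cexp]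
          congr 2
          have hsC : (s : ℂ) ≠ 0 := Complex.ofReal_ne_zero.2 hs
          have hx : (x + Complex.I * (-(w * Complex.I)) : ℂ) = x + w := by
            linear_combination (-(w : ℂ)) * Complex.I_sq
          have hI : (-Real.pi / (-(s * Complex.I)) : ℂ) = -(Real.pi * Complex.I / s) := by
            field_simp
            rw [Complex.I_sq, neg_neg]
          rw [hx, hI]
          push_cast
          field_simp
          ring
  · filter_upwards [self_mem_nhdsWithin] with ε hε
    exact integral_gaussian_mul_fourier h (by simpa [b] using hε) _

/-- Conjugating a chirp by the Fourier transform. -/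
lemma exists_fourierL_chirpL_fourierL {s : ℝ} (hs : s ≠ 0) : ∃ z : ℂ, ‖z‖ = 1 ∧ ∀ f : L2R,
    fourierL (chirpL s (fourierL f)) =
      z • chirpL (-s⁻¹) (dil s⁻¹ (inv_ne_zero hs) (fourierL (chirpL (-s⁻¹) f))) := by
  have hp : 0 < |s| := abs_pos.2 hs
  have hpow : (0 : ℝ) < |s| ^ (1 / 2 : ℝ) := Real.rpow_pos_of_pos hp _
  -- The factor `|s|^{1/2}` compensates the normalisation `|s|^{-1/2}` of the dilation by `s⁻¹`,
  -- leaving a constant of modulus one.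
  refine ⟨((|s| ^ (1 / 2 : ℝ) : ℝ) : ℂ) * (1 / (-(s * Complex.I) : ℂ) ^ (1 / 2 : ℂ)), ?_,
    fun f => ?_⟩
  · have h : ‖(-(s * Complex.I) : ℂ) ^ (1 / 2 : ℂ)‖ = |s| ^ (1 / 2 : ℝ) := by
      have := Complex.norm_cpow_real (-(s * Complex.I) : ℂ) (1 / 2)
      push_cast at this
      rw [this]
      simp
    rw [norm_mul, norm_div, h, Complex.norm_real, Real.norm_of_nonneg hpow.le, norm_one,
      mul_one_div_cancel hpow.ne']
  refine schwartz_induction (p := fun f => fourierL (chirpL s (fourierL f)) =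
      _ • chirpL (-s⁻¹) (dil s⁻¹ (inv_ne_zero hs) (fourierL (chirpL (-s⁻¹) f))))
    (isClosed_eq (by fun_prop) (by fun_prop)) (fun g => ?_) f
  have hc : ∀ (t : ℝ) (h : 𝓢(ℝ, ℂ)), chirpL t (h.toLp 2) =ᵐ[volume]
      fun w => e ((1 / 2) * t * w ^ 2) * h w := fun t h => by
    filter_upwards [coeFn_chirpL t (h.toLp 2), h.coeFn_toLp 2 volume] with w h₁ h₂
    rw [h₁, h₂]
  have hci : ∀ (t : ℝ) (h : 𝓢(ℝ, ℂ)), Integrable (chirpL t (h.toLp 2)) := fun t h => by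
    refine Integrable.congr (h.integrable.mono ?_ (Eventually.of_forall fun w => ?_)) (hc t h).symm
    · exact ((continuous_e.comp (by fun_prop)).mul h.continuous).aestronglyMeasurable
    · simp [norm_e]
  rw [fourierL_toLp]
  refine Lp.ext ?_
  set D := dil s⁻¹ (inv_ne_zero hs) (fourierL (chirpL (-s⁻¹) (g.toLp 2))) with hD
  filter_upwards [coeFn_fourierL (hci s (𝓕 g)) (hc s (𝓕 g)), Lp.coeFn_smul
    (((|s| ^ (1 / 2 : ℝ) : ℝ) : ℂ) * (1 / (-(s * Complex.I) : ℂ) ^ (1 / 2 : ℂ))) (chirpL (-s⁻¹) D),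
    coeFn_chirpL (-s⁻¹) D, coeFn_dil s⁻¹ (inv_ne_zero hs) (fourierL (chirpL (-s⁻¹) (g.toLp 2))),
    (quasiMeasurePreserving_mul (inv_ne_zero hs)).ae
      (coeFn_fourierL (hci (-s⁻¹) g) (hc (-s⁻¹) g))] with w h₁ h₂ h₃ h₄ h₅
  rw [h₁, h₂, Pi.smul_apply, h₃, hD, h₄, h₅, integral_chirp_mul_fourier g hs, smul_eq_mul, abs_inv,
    Real.inv_rpow hp.le, Complex.ofReal_inv]
  have := Complex.ofReal_ne_zero.2 hpow.ne'
  field_simp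


/-! ### The metaplectic operators and the action of `S` and `T` -/

lemma dil_congr {s t : ℝ} (hs : s ≠ 0) (ht : t ≠ 0) (h : s = t) (f : L2R) :
    dil s hs f = dil t ht f := by
  subst h
  rfl

/-- `f_φ` as an element of `L²(ℝ)`. -/
def rotL (φ : ℝ) (f : L2R) : L2R := (memLp_rot φ f).toLp

lemma rotL_of_sin_ne_zero {φ : ℝ} (h : Real.sin φ ≠ 0) (f : L2R) :
    rotL φ f = chirpL (Real.cos φ / Real.sin φ) (dil (Real.sin φ)⁻¹ (inv_ne_zero h)
      (fourierL (chirpL (Real.cos φ / Real.sin φ) f))) := by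
  obtain ⟨h0, h1⟩ := (sin_ne_zero_iff φ).1 h
  refine Lp.ext ?_
  set g := fourierL (chirpL (Real.cos φ / Real.sin φ) f) with hg
  filter_upwards [MemLp.coeFn_toLp (memLp_rot φ f),
    coeFn_chirpL (Real.cos φ / Real.sin φ) (dil (Real.sin φ)⁻¹ (inv_ne_zero h) g),
    coeFn_dil (Real.sin φ)⁻¹ (inv_ne_zero h) g] with w h₁ h₂ h₃
  rw [rotL, h₁, h₂, h₃, rot, if_neg h0, if_neg h1, abs_inv, Real.inv_rpow (abs_nonneg _),
    Real.rpow_neg (abs_nonneg _), mul_left_comm, div_eq_inv_mul w]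
  rfl

lemma rotL_of_eq_zero {φ : ℝ} (h : (φ : Real.Angle) = 0) (f : L2R) : rotL φ f = f := by
  refine Lp.ext ?_
  filter_upwards [MemLp.coeFn_toLp (memLp_rot φ f)] with w h₁
  rw [rotL, h₁, rot, if_pos h]

lemma rotL_of_eq_pi {φ : ℝ} (h : (φ : Real.Angle) = (Real.pi : ℝ)) (f : L2R) :
    rotL φ f = dil (-1) (by norm_num) f := by
  have h0 : (φ : Real.Angle) ≠ 0 := h ▸ Real.Angle.pi_ne_zero
  refine Lp.ext ?_
  filter_upwards [MemLp.coeFn_toLp (memLp_rot φ f), coeFn_dil (-1) (by norm_num) f] with w h₁ h₂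
  rw [rotL, h₁, h₂, rot, if_neg h0, if_pos h]
  simp

lemma rpow_im_ne_zero (τ : UpperHalfPlane) : τ.im ^ (1 / 2 : ℝ) ≠ 0 :=
  (Real.rpow_pos_of_pos τ.im_pos _).ne'

/-- The function `w ↦ v^{1/4} e(½ u w²) f_φ(v^{1/2} w)`, whose Zak transform is the theta
function. -/
def iwasawaOp (τ : UpperHalfPlane) (φ : ℝ) (f : L2R) : L2R :=
  chirpL τ.re (dil (τ.im ^ (1 / 2 : ℝ)) (rpow_im_ne_zero τ) (rotL φ f))

/-- `iwasawaOp` in the Iwasawa coordinates of `M`: up to a phase, the metaplectic representation. -/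
def metaOp (M : SL(2, ℝ)) (f : L2R) : L2R := iwasawaOp (tau M) (phi M) f

lemma iwasawa_entries (M : SL(2, ℝ)) :
    M 0 0 = (tau M).im ^ (1 / 2 : ℝ) * Real.cos (phi M) +
        (tau M).re * ((tau M).im ^ (1 / 2 : ℝ))⁻¹ * Real.sin (phi M) ∧
    M 0 1 = -((tau M).im ^ (1 / 2 : ℝ) * Real.sin (phi M)) +
        (tau M).re * ((tau M).im ^ (1 / 2 : ℝ))⁻¹ * Real.cos (phi M) ∧
    M 1 0 = ((tau M).im ^ (1 / 2 : ℝ))⁻¹ * Real.sin (phi M) ∧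
    M 1 1 = ((tau M).im ^ (1 / 2 : ℝ))⁻¹ * Real.cos (phi M) := by
  have h := iwasawa M
  rw [Real.rpow_neg (tau M).im_pos.le] at h
  refine ⟨?_, ?_, ?_, ?_⟩
  · simpa [Matrix.mul_apply, Fin.sum_univ_two] using congrFun (congrFun h 0) 0
  · simpa [Matrix.mul_apply, Fin.sum_univ_two] using congrFun (congrFun h 0) 1
  · simpa [Matrix.mul_apply, Fin.sum_univ_two] using congrFun (congrFun h 1) 0
  · simpa [Matrix.mul_apply, Fin.sum_univ_two] using congrFun (congrFun h 1) 1

lemma det_eq (M : SL(2, ℝ)) : M 0 0 * M 1 1 - M 0 1 * M 1 0 = 1 := by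
  have := M.det_coe
  rwa [Matrix.det_fin_two] at this

/-- The Bruhat form of the operator, with kernel `|c|^{-1/2} e((½ a w² - w w' + ½ d w'²)/c)`. The
Iwasawa coordinates disappear, so both left multiplication by `S`, `T` and continuity can be read
off the matrix entries. -/
lemma metaOp_of_ne_zero (M : SL(2, ℝ)) (hc : M 1 0 ≠ 0) (f : L2R) :
    metaOp M f = chirpL (M 0 0 / M 1 0) (dil (M 1 0)⁻¹ (inv_ne_zero hc)
      (fourierL (chirpL (M 1 1 / M 1 0) f))) := by
  obtain ⟨h00, -, h10, h11⟩ := iwasawa_entries M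
  obtain ⟨q, hqd⟩ : ∃ q, (tau M).im ^ (1 / 2 : ℝ) = q := ⟨_, rfl⟩
  have hq : q ≠ 0 := hqd ▸ rpow_im_ne_zero (tau M)
  rw [hqd] at h00 h10 h11
  rw [metaOp, iwasawaOp, dil_congr _ hq hqd]
  have hs : Real.sin (phi M) ≠ 0 := fun h => hc (by rw [h10, h, mul_zero])
  have hcot : Real.cos (phi M) / Real.sin (phi M) = M 1 1 / M 1 0 := by
    rw [h10, h11]
    field_simp
  rw [rotL_of_sin_ne_zero hs, dil_chirpL, chirpL_chirpL, dil_dil, hcot,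
    dil_congr _ (inv_ne_zero hc) (by rw [h10]; field_simp)]
  congr 2
  rw [h00, h11, h10]
  field_simp
  ring

lemma metaOp_of_eq_zero (M : SL(2, ℝ)) (hc : M 1 0 = 0) (ha : M 0 0 ≠ 0) (f : L2R) :
    metaOp M f = chirpL (M 0 0 * M 0 1) (dil (M 0 0) ha f) := by
  obtain ⟨h00, h01, h10, h11⟩ := iwasawa_entries M
  obtain ⟨q, hqd⟩ : ∃ q, (tau M).im ^ (1 / 2 : ℝ) = q := ⟨_, rfl⟩
  have hq : q ≠ 0 := hqd ▸ rpow_im_ne_zero (tau M)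
  rw [hqd] at h00 h01 h10 h11
  rw [metaOp, iwasawaOp, dil_congr _ hq hqd]
  have hs : Real.sin (phi M) = 0 := by
    rw [h10] at hc
    exact (mul_eq_zero.1 hc).resolve_left (inv_ne_zero hq)
  have hcos : Real.cos (phi M) * Real.cos (phi M) = 1 := by
    have := Real.sin_sq_add_cos_sq (phi M)
    rw [hs] at this
    linarith
  have hu : M 0 0 * M 0 1 = (tau M).re := by
    rw [h00, h01, hs]
    linear_combination (tau M).re * Real.cos (phi M) ^ 2 * mul_inv_cancel₀ hq + (tau M).re * hcos
  rw [hu]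
  congr 1
  -- Here `φ` is `0` or `π` modulo `2π`; the sign of `M 0 0` is that of `cos φ`, so the reflection
  -- in `f_π` is absorbed into a dilation by a negative number.
  rw [← Real.Angle.sin_coe, Real.Angle.sin_eq_zero_iff] at hs
  have hsin : Real.sin (phi M) = 0 := by
    rw [← Real.Angle.sin_coe, Real.Angle.sin_eq_zero_iff]
    exact hs
  rcases hs with h | h
  · have hcos1 : Real.cos (phi M) = 1 := by rw [← Real.Angle.cos_coe, h, Real.Angle.cos_zero]
    rw [rotL_of_eq_zero h]
    exact dil_congr _ _ (by rw [h00, hsin, hcos1]; ring) f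
  · have hcos1 : Real.cos (phi M) = -1 := by rw [← Real.Angle.cos_coe, h, Real.Angle.cos_coe_pi]
    rw [rotL_of_eq_pi h, dil_dil]
    exact dil_congr _ _ (by rw [h00, hsin, hcos1]; ring) f

/-- The image of `S` in `SL(2,ℝ)`. -/
def SR : SL(2, ℝ) := Matrix.SpecialLinearGroup.map (Int.castRingHom ℝ) ModularGroup.S

/-- The image of `T` in `SL(2,ℝ)`. -/
def TR : SL(2, ℝ) := Matrix.SpecialLinearGroup.map (Int.castRingHom ℝ) ModularGroup.T

lemma coe_SR : (SR : Matrix (Fin 2) (Fin 2) ℝ) = !![0, -1; 1, 0] := by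
  rw [SR, Matrix.SpecialLinearGroup.map_apply_coe, ModularGroup.coe_S]
  ext i j
  fin_cases i <;> fin_cases j <;> simp

lemma coe_TR : (TR : Matrix (Fin 2) (Fin 2) ℝ) = !![1, 1; 0, 1] := by
  rw [TR, Matrix.SpecialLinearGroup.map_apply_coe, ModularGroup.coe_T]
  ext i j
  fin_cases i <;> fin_cases j <;> simp

lemma SR_mul_entries (M : SL(2, ℝ)) : (SR * M) 0 0 = -M 1 0 ∧ (SR * M) 0 1 = -M 1 1 ∧
    (SR * M) 1 0 = M 0 0 ∧ (SR * M) 1 1 = M 0 1 := by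
  simp [coe_SR, Matrix.mul_apply, Fin.sum_univ_two]

lemma TR_mul_entries (M : SL(2, ℝ)) : (TR * M) 0 0 = M 0 0 + M 1 0 ∧
    (TR * M) 0 1 = M 0 1 + M 1 1 ∧ (TR * M) 1 0 = M 1 0 ∧ (TR * M) 1 1 = M 1 1 := by
  simp [coe_TR, Matrix.mul_apply, Fin.sum_univ_two]

lemma metaOp_TR_mul (M : SL(2, ℝ)) (f : L2R) : metaOp (TR * M) f = chirpL 1 (metaOp M f) := by
  obtain ⟨h00, h01, h10, h11⟩ := TR_mul_entries M
  by_cases hc : M 1 0 = 0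
  · have hdet := det_eq M
    rw [hc, mul_zero, sub_zero] at hdet
    have ha : M 0 0 ≠ 0 := left_ne_zero_of_mul_eq_one hdet
    have hc' : (TR * M) 1 0 = 0 := h10.trans hc
    have h00' : (TR * M) 0 0 = M 0 0 := by rw [h00, hc, add_zero]
    rw [metaOp_of_eq_zero M hc ha, metaOp_of_eq_zero (TR * M) hc' (h00' ▸ ha), chirpL_chirpL,
      dil_congr _ ha h00', h00', h01, mul_add, hdet, add_comm]
  · have hc' : (TR * M) 1 0 ≠ 0 := h10 ▸ hc
    rw [metaOp_of_ne_zero M hc, metaOp_of_ne_zero (TR * M) hc', chirpL_chirpL,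
      dil_congr _ (inv_ne_zero hc) (congrArg _ h10), h00, h10, h11, add_div, div_self hc, add_comm]

/-- With `a = M 0 0` and `c = M 1 0`, three cases arise. If `c = 0`, the Fourier transform only
passes a dilation; if `a = 0`, two Fourier transforms collapse to a reflection; otherwise the inner
chirp is conjugated by `exists_fourierL_chirpL_fourierL`, the only source of a nontrivial phase. -/
lemma fourierL_metaOp (M : SL(2, ℝ)) (f : L2R) :
    ∃ z : ℂ, ‖z‖ = 1 ∧ fourierL (metaOp M f) = z • metaOp (SR * M) f := by
  obtain ⟨h00, h01, h10, h11⟩ := SR_mul_entries M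
  have hdet := det_eq M
  by_cases hc : M 1 0 = 0
  · rw [hc, mul_zero, sub_zero] at hdet
    have ha : M 0 0 ≠ 0 := left_ne_zero_of_mul_eq_one hdet
    refine ⟨1, norm_one, ?_⟩
    have hc' : (SR * M) 1 0 ≠ 0 := h10 ▸ ha
    have h1 : chirpL (M 0 0 * M 0 1) (dil (M 0 0) ha f) =
        dil (M 0 0) ha (chirpL (M 0 1 / M 0 0) f) := by
      rw [dil_chirpL]
      congr 2
      field_simp
    rw [one_smul, metaOp_of_eq_zero M hc ha, metaOp_of_ne_zero (SR * M) hc', h1, fourierL_dil,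
      dil_congr _ (inv_ne_zero ha) (congrArg _ h10), h00, h10, h11, hc, neg_zero, zero_div]
    refine Lp.ext ?_
    filter_upwards [coeFn_chirpL 0
      (dil (M 0 0)⁻¹ (inv_ne_zero ha) (fourierL (chirpL (M 0 1 / M 0 0) f)))] with w hw
    rw [hw]
    simp [e]
  · by_cases ha : M 0 0 = 0
    · refine ⟨1, norm_one, ?_⟩
      have hc' : (SR * M) 1 0 = 0 := h10.trans ha
      have ha' : (SR * M) 0 0 ≠ 0 := by rw [h00]; exact neg_ne_zero.2 hc
      have hz : ∀ g : L2R, chirpL (0 / M 1 0) g = g := fun g => by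
        refine Lp.ext ?_
        filter_upwards [coeFn_chirpL (0 / M 1 0) g] with w hw
        rw [hw]
        simp [e]
      rw [one_smul, metaOp_of_ne_zero M hc, ha, hz, metaOp_of_eq_zero (SR * M) hc' ha',
        fourierL_dil, fourierL_fourierL, dil_dil, dil_chirpL, dil_congr _ ha' (by rw [h00]; simp)]
      congr 2
      rw [h00, h01]
      field_simp
    · obtain ⟨z, hz, h⟩ := exists_fourierL_chirpL_fourierL (div_ne_zero ha hc)
      refine ⟨z, hz, ?_⟩
      have hc' : (SR * M) 1 0 ≠ 0 := h10 ▸ ha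
      have h1 : dil (M 1 0)⁻¹ (inv_ne_zero hc) (fourierL (chirpL (M 1 1 / M 1 0) f)) =
          fourierL (dil (M 1 0) hc (chirpL (M 1 1 / M 1 0) f)) := by
        rw [fourierL_dil]
      -- The two chirps have parameters `-c/a` and, once moved past the dilation by `c`, `cd`; the
      -- determinant condition combines them into `b/a`.
      have h2 : chirpL (-(M 0 0 / M 1 0)⁻¹) (dil (M 1 0) hc (chirpL (M 1 1 / M 1 0) f)) =
          dil (M 1 0) hc (chirpL (M 0 1 / M 0 0) f) := by
        rw [dil_chirpL, dil_chirpL, chirpL_chirpL]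
        congr 2
        field_simp
        linear_combination hdet
      rw [metaOp_of_ne_zero M hc, metaOp_of_ne_zero (SR * M) hc', h1, h, h2, fourierL_dil, dil_dil,
        dil_congr _ (inv_ne_zero ha) (show (M 1 0)⁻¹ * (M 0 0 / M 1 0)⁻¹ = (M 0 0)⁻¹ by field_simp),
        dil_congr _ (inv_ne_zero ha) (congrArg _ h10), h00, h10, h11, inv_div, neg_div]

lemma continuous_metaOp (f : L2R) :
    Continuous fun M : {M : SL(2, ℝ) // M 1 0 ≠ 0} => metaOp M f := by
  have hent : ∀ i j, Continuous fun M : {M : SL(2, ℝ) // M 1 0 ≠ 0} => (M : SL(2, ℝ)) i j :=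
    fun i j => (Continuous.matrix_elem continuous_subtype_val i j).comp continuous_subtype_val
  have h1 : Continuous fun M : {M : SL(2, ℝ) // M 1 0 ≠ 0} =>
      fourierL (chirpL ((M : SL(2, ℝ)) 1 1 / (M : SL(2, ℝ)) 1 0) f) :=
    fourierL.continuous.comp ((continuous_chirpL f).comp ((hent 1 1).div (hent 1 0) fun M => M.2))
  have h2 := continuous_isometry_family
    (T := fun M : {M : SL(2, ℝ) // M 1 0 ≠ 0} => dil ((M : SL(2, ℝ)) 1 0)⁻¹ (inv_ne_zero M.2))
    (fun g => (continuous_dil g).comp (Continuous.subtype_mk (p := fun t : ℝ => t ≠ 0) ((hent 1 0).inv₀ fun M => M.2)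
      fun M => inv_ne_zero M.2)) h1
  have h3 := continuous_isometry_family
    (T := fun M : {M : SL(2, ℝ) // M 1 0 ≠ 0} => chirpL ((M : SL(2, ℝ)) 0 0 / (M : SL(2, ℝ)) 1 0))
    (fun g => (continuous_chirpL g).comp ((hent 0 0).div (hent 1 0) fun M => M.2)) h2
  exact h3.congr fun M => (metaOp_of_ne_zero M M.2 f).symm


/-! ### The Zak transform as an isometry -/

lemma torus1_eq_Ioc : torus1 = volume.restrict (Set.Ioc 0 1) :=
  Measure.restrict_congr_set Ico_ae_eq_Ioc

lemma quasiMeasurePreserving_sub_snd (n : ℤ) :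
    Measure.QuasiMeasurePreserving (fun ξ : ℝ × ℝ => (n : ℝ) - ξ.2) torus2 volume := by
  have h1 : Measure.QuasiMeasurePreserving (fun y : ℝ => (n : ℝ) - y) torus1 volume :=
    (Measure.measurePreserving_sub_left volume (n : ℝ)).quasiMeasurePreserving.mono
      Measure.restrict_le_self.absolutelyContinuous Measure.AbsolutelyContinuous.rfl
  exact h1.comp Measure.quasiMeasurePreserving_snd

lemma memLp_zakTerm (n : ℤ) (g : L2R) :
    MemLp (fun ξ : ℝ × ℝ => e (n * ξ.1) * g (n - ξ.2)) 2 torus2 := by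
  refine memLp_e_mul (by fun_prop) ?_
  have h := ((Lp.memLp g).comp_measurePreserving
    (Measure.measurePreserving_sub_left volume (n : ℝ))).restrict (Set.Ico 0 1)
  exact h.comp_snd torus1

/-- The `n`-th term `(x, y) ↦ e(n x) g(n - y)` of the Zak transform. -/
def zakTerm (n : ℤ) : L2R →ₗ[ℂ] Lp ℂ 2 torus2 where
  toFun g := (memLp_zakTerm n g).toLp
  map_add' g₁ g₂ := by
    refine Lp.ext ?_
    filter_upwards [MemLp.coeFn_toLp (memLp_zakTerm n (g₁ + g₂)),
      (quasiMeasurePreserving_sub_snd n).ae (Lp.coeFn_add g₁ g₂),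
      Lp.coeFn_add (memLp_zakTerm n g₁).toLp (memLp_zakTerm n g₂).toLp,
      MemLp.coeFn_toLp (memLp_zakTerm n g₁),
      MemLp.coeFn_toLp (memLp_zakTerm n g₂)] with x h₁ h₂ h₃ h₄ h₅
    rw [h₁, h₂, h₃, Pi.add_apply, Pi.add_apply, h₄, h₅, mul_add]
  map_smul' c g := by
    refine Lp.ext ?_
    filter_upwards [MemLp.coeFn_toLp (memLp_zakTerm n (c • g)),
      (quasiMeasurePreserving_sub_snd n).ae (Lp.coeFn_smul c g),
      Lp.coeFn_smul c (memLp_zakTerm n g).toLp,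
      MemLp.coeFn_toLp (memLp_zakTerm n g)] with x h₁ h₂ h₃ h₄
    simp only [RingHom.id_apply]
    rw [h₁, h₂, h₃, Pi.smul_apply, Pi.smul_apply, h₄, smul_eq_mul, smul_eq_mul, mul_left_comm]

lemma coeFn_zakTerm (n : ℤ) (g : L2R) :
    zakTerm n g =ᵐ[torus2] fun ξ => e (n * ξ.1) * g (n - ξ.2) :=
  MemLp.coeFn_toLp (memLp_zakTerm n g)

lemma term_eq_zakTerm (f : L2R) (τ : UpperHalfPlane) (φ : ℝ) (n : ℤ) :
    term f τ φ n = zakTerm n (iwasawaOp τ φ f) := by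
  refine Lp.ext ?_
  have hq := rpow_im_ne_zero τ
  filter_upwards [MemLp.coeFn_toLp (memLp_termFun f τ φ n), coeFn_zakTerm n (iwasawaOp τ φ f),
    (quasiMeasurePreserving_sub_snd n).ae
      (coeFn_chirpL τ.re (dil (τ.im ^ (1 / 2 : ℝ)) hq (rotL φ f))),
    (quasiMeasurePreserving_sub_snd n).ae (coeFn_dil (τ.im ^ (1 / 2 : ℝ)) hq (rotL φ f)),
    ((quasiMeasurePreserving_mul hq).comp (quasiMeasurePreserving_sub_snd n)).ae
      (MemLp.coeFn_toLp (memLp_rot φ f))] with ξ h₁ h₂ h₃ h₄ h₅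
  rw [Function.comp_apply] at h₅
  rw [term, h₁, h₂, iwasawaOp, h₃, h₄, rotL, h₅, termFun, e_add,
    abs_of_nonneg (Real.rpow_nonneg τ.im_pos.le _), ← Real.rpow_mul τ.im_pos.le,
    mul_comm (τ.im ^ (1 / 2 : ℝ)) ((n : ℝ) - ξ.2)]
  have h6 : (1 / 2 : ℝ) * ((n : ℝ) - ξ.2) ^ 2 * τ.re = 1 / 2 * τ.re * ((n : ℝ) - ξ.2) ^ 2 := by ring
  rw [h6]
  norm_num
  ring

lemma e_intCast (k : ℤ) : e k = 1 := by
  rw [e]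
  have := Complex.exp_int_mul_two_pi_mul_I k
  rw [← this]
  congr 1
  push_cast
  ring

lemma integral_e_int_mul {k : ℤ} (hk : k ≠ 0) : ∫ x, e (k * x) ∂torus1 = 0 := by
  rw [torus1_eq_Ioc, ← intervalIntegral.integral_of_le zero_le_one]
  have hc : (2 * Real.pi * k * Complex.I : ℂ) ≠ 0 := by
    simp [Real.pi_ne_zero, hk]
  have h := integral_exp_mul_complex (a := 0) (b := 1) hc
  have h1 := e_intCast k
  rw [e] at h1
  push_cast at h1
  have h2 : ∀ x : ℝ, e (k * x) = Complex.exp (2 * Real.pi * k * Complex.I * x) := fun x => by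
    rw [e]
    congr 1
    push_cast
    ring
  simp only [h2]
  rw [h]
  simp [h1]

lemma conj_e (x : ℝ) : (starRingEnd ℂ) (e x) = e (-x) := by
  rw [e, e, ← Complex.exp_conj]
  congr 1
  simp [Complex.conj_ofNat]

/-- The variables separate, so orthogonality for `m ≠ n` comes from the `x`-integral alone. -/
lemma inner_zakTerm (m n : ℤ) (f g : L2R) : inner ℂ (zakTerm m f) (zakTerm n g) =
    (∫ x, e (((n - m : ℤ) : ℝ) * x) ∂torus1) *
      ∫ y, (starRingEnd ℂ) (f (m - y)) * g (n - y) ∂torus1 := by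
  rw [L2.inner_def, ← integral_prod_mul]
  refine integral_congr_ae ?_
  filter_upwards [coeFn_zakTerm m f, coeFn_zakTerm n g] with ξ h₁ h₂
  have h3 : e (((n - m : ℤ) : ℝ) * ξ.1) = e (n * ξ.1) * e (-(m * ξ.1)) := by
    rw [← e_add]
    congr 1
    push_cast
    ring
  rw [h₁, h₂, RCLike.inner_apply, map_mul, conj_e, h3]
  ring

lemma inner_zakTerm_of_ne {m n : ℤ} (h : m ≠ n) (f g : L2R) :
    inner ℂ (zakTerm m f) (zakTerm n g) = 0 := by
  rw [inner_zakTerm, integral_e_int_mul (sub_ne_zero.2 h.symm), zero_mul]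

lemma norm_sq_zakTerm (n : ℤ) (g : L2R) :
    ((‖zakTerm n g‖ ^ 2 : ℝ) : ℂ) = ∫ y in (0 : ℝ)..1, (starRingEnd ℂ) (g (n - y)) * g (n - y) := by
  have h := inner_self_eq_norm_sq_to_K (𝕜 := ℂ) (zakTerm n g)
  push_cast
  rw [intervalIntegral.integral_of_le zero_le_one, ← torus1_eq_Ioc]
  refine h.symm.trans ?_
  rw [inner_zakTerm]
  simp [e]

lemma hasSum_norm_sq_zakTerm (g : L2R) : HasSum (fun n => ‖zakTerm n g‖ ^ 2) (‖g‖ ^ 2) := by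
  rw [← Complex.hasSum_ofReal]
  have hint : Integrable (fun y => (starRingEnd ℂ) (g y) * g y) := by
    simpa only [RCLike.inner_apply, mul_comm] using L2.integrable_inner (𝕜 := ℂ) g g
  have h := (hint.comp_neg).hasSum_intervalIntegral_comp_add_int
  rw [integral_neg_eq_self (fun y => (starRingEnd ℂ) (g y) * g y)] at h
  have hg : ((‖g‖ ^ 2 : ℝ) : ℂ) = ∫ y, (starRingEnd ℂ) (g y) * g y := by
    have h := inner_self_eq_norm_sq_to_K (𝕜 := ℂ) g
    rw [L2.inner_def] at h
    push_cast
    refine h.symm.trans (integral_congr_ae (Eventually.of_forall fun y => ?_))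
    exact (RCLike.inner_apply _ _).trans (mul_comm _ _)
  -- The terms involve `g (n - y)`, so the tiling by integer translates is applied to `y ↦ g (-y)`,
  -- with `n` replaced by `-n`.
  rw [hg, ← (Equiv.neg ℤ).hasSum_iff]
  have h' : (fun n : ℤ => ((‖zakTerm n g‖ ^ 2 : ℝ) : ℂ)) ∘ Equiv.neg ℤ =
      fun n : ℤ => ∫ x in (0 : ℝ)..1, (starRingEnd ℂ) (g (-(x + n))) * g (-(x + n)) := by
    funext n
    simp only [Function.comp_apply, Equiv.neg_apply]
    rw [norm_sq_zakTerm]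
    push_cast
    simp only [neg_add', sub_eq_add_neg, add_comm]
  rw [h']
  exact h

/-- Spans are used so that a term may vanish: a family of lines or zero subspaces needs no
normalised vectors. -/
lemma orthogonalFamily_zakTerm (g : L2R) : OrthogonalFamily ℂ
    (fun n : ℤ => Submodule.span ℂ {zakTerm n g})
    fun n => (Submodule.span ℂ {zakTerm n g}).subtypeₗᵢ := by
  refine OrthogonalFamily.of_pairwise fun m n hmn => ?_
  refine Submodule.isOrtho_span.2 ?_
  rintro u rfl v rfl
  exact inner_zakTerm_of_ne hmn g g

lemma summable_zakTerm (g : L2R) : Summable fun n => zakTerm n g := by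
  have h := (orthogonalFamily_zakTerm g).summable_iff_norm_sq_summable
    fun n => ⟨zakTerm n g, Submodule.mem_span_singleton_self _⟩
  exact h.2 (hasSum_norm_sq_zakTerm g).summable

lemma norm_tsum_zakTerm (g : L2R) : ‖∑' n, zakTerm n g‖ = ‖g‖ := by
  have h1 : Tendsto (fun s : Finset ℤ => ‖∑ n ∈ s, zakTerm n g‖ ^ 2) atTop
      (𝓝 (‖∑' n, zakTerm n g‖ ^ 2)) := ((summable_zakTerm g).hasSum.norm).pow 2
  have h2 : ∀ s : Finset ℤ, ‖∑ n ∈ s, zakTerm n g‖ ^ 2 = ∑ n ∈ s, ‖zakTerm n g‖ ^ 2 := fun s =>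
    (orthogonalFamily_zakTerm g).norm_sum
      (fun n => ⟨zakTerm n g, Submodule.mem_span_singleton_self _⟩) s
  simp only [h2] at h1
  have h3 := tendsto_nhds_unique h1 (hasSum_norm_sq_zakTerm g)
  exact (sq_eq_sq₀ (norm_nonneg _) (norm_nonneg _)).1 h3

/-- The Zak transform `g ↦ ∑ₙ e(n x) g(n - y)`, an isometry from `L²(ℝ)` to `L²(𝕋²)`. -/
def zak : L2R →ₗᵢ[ℂ] Lp ℂ 2 torus2 where
  toFun g := ∑' n, zakTerm n g
  map_add' g₁ g₂ := by
    simp only [map_add]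
    exact (summable_zakTerm g₁).tsum_add (summable_zakTerm g₂)
  map_smul' c g := by
    simp only [map_smul, RingHom.id_apply]
    exact (summable_zakTerm g).tsum_const_smul c
  norm_map' g := norm_tsum_zakTerm g

lemma zak_apply (g : L2R) : zak g = ∑' n, zakTerm n g := rfl

lemma Theta_eq_zak (f : L2R) (τ : UpperHalfPlane) (φ : ℝ) :
    Theta f τ φ = zak (iwasawaOp τ φ f) := by
  simp only [Theta, zak_apply, term_eq_zakTerm]

/-! ### Torus maps, and the Zak transform under `T` and `S` -/

/-- The representative in `(0, 1]` of a real number modulo `1`. -/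
def toUnitIoc (t : ℝ) : ℝ := (AddCircle.equivIoc 1 0 (t : AddCircle (1 : ℝ)) : ℝ)

lemma exists_toUnitIoc (t : ℝ) : ∃ k : ℤ, toUnitIoc t = t + k := by
  have h : ((toUnitIoc t : ℝ) : AddCircle (1 : ℝ)) = t := AddCircle.coe_equivIoc
  rw [← sub_eq_zero, ← AddCircle.coe_sub, AddCircle.coe_eq_zero_iff] at h
  obtain ⟨k, hk⟩ := h
  refine ⟨k, ?_⟩
  rw [zsmul_eq_mul, mul_one] at hk
  linarith

lemma measurePreserving_equivIoc_coe : MeasurePreserving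
    (fun t : AddCircle (1 : ℝ) => (AddCircle.equivIoc 1 0 t : ℝ)) volume torus1 := by
  have h := (measurePreserving_subtype_coe (μa := (volume : Measure ℝ))
    (measurableSet_Ioc (a := (0 : ℝ)) (b := 0 + 1))).comp
    (AddCircle.measurePreserving_equivIoc (1 : ℝ) (a := 0))
  have h0 : (volume.restrict (Set.Ioc (0 : ℝ) (0 + 1))) = torus1 := by
    rw [torus1_eq_Ioc, zero_add]
  rw [h0] at h
  exact h

lemma measurable_toUnitIoc : Measurable toUnitIoc :=
  measurePreserving_equivIoc_coe.measurable.comp AddCircle.measurable_mk'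

/-- On the fundamental domain this is translation by `c` on the circle, which preserves Haar
measure. -/
lemma measurePreserving_toUnitIoc_add (c : ℝ) :
    MeasurePreserving (fun x => toUnitIoc (x + c)) torus1 torus1 := by
  have h1 := AddCircle.measurePreserving_mk (1 : ℝ) 0
  rw [zero_add, ← torus1_eq_Ioc] at h1
  exact (measurePreserving_equivIoc_coe.comp
    (measurePreserving_add_right volume (c : AddCircle (1 : ℝ)))).comp h1

lemma measurePreserving_shear : MeasurePreserving
    (fun ξ : ℝ × ℝ => (toUnitIoc (ξ.1 - ξ.2 + 1 / 2), ξ.2)) torus2 torus2 := by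
  have h := MeasurePreserving.skew_product (μa := torus1) (μb := torus1) (μc := torus1)
    (μd := torus1) (MeasurePreserving.id torus1) (g := fun y x => toUnitIoc (x + (-y + 1 / 2)))
    (measurable_toUnitIoc.comp (by fun_prop))
    (Eventually.of_forall fun y => (measurePreserving_toUnitIoc_add _).map_eq)
  have h2 := (Measure.measurePreserving_swap.comp h).comp Measure.measurePreserving_swap
  have h3 : (fun ξ : ℝ × ℝ => (toUnitIoc (ξ.1 - ξ.2 + 1 / 2), ξ.2)) =
      (Prod.swap ∘ fun p : ℝ × ℝ => (id p.1, toUnitIoc (p.2 + (-p.1 + 1 / 2)))) ∘ Prod.swap := by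
    funext ξ
    simp only [Function.comp_apply, Prod.swap, id]
    rw [← add_assoc, sub_eq_add_neg]
  rw [h3]
  exact h2

lemma measurePreserving_one_sub : MeasurePreserving (fun y : ℝ => 1 - y) torus1 torus1 := by
  have h := (Measure.measurePreserving_sub_left (volume : Measure ℝ) 1).restrict_preimage
    (measurableSet_Ioc (a := (0 : ℝ)) (b := 1))
  rw [← torus1_eq_Ioc] at h
  -- The reflection swaps the half-open intervals, which define the same measure `torus1`.
  have h2 : (fun y : ℝ => 1 - y) ⁻¹' Set.Ioc 0 1 = Set.Ico 0 1 := by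
    simp
  rw [h2] at h
  exact h

lemma measurePreserving_quarterTurn :
    MeasurePreserving (fun ξ : ℝ × ℝ => (1 - ξ.2, ξ.1)) torus2 torus2 :=
  (measurePreserving_one_sub.prod (MeasurePreserving.id torus1)).comp
    Measure.measurePreserving_swap

/-- Expanding `½(n - y)²` gives the phase `½ y²`, the shift `-n y` of `n x`, and `½ n²`. Modulo one,
`½ n²` equals `½ n`, whence the shift by `1/2` in the shear. -/
lemma zak_chirpL_one (g : L2R) : zak (chirpL 1 g) = phaseMul (fun ξ => (1 / 2) * ξ.2 ^ 2)
    (by fun_prop) (Lp.compMeasurePreservingₗᵢ ℂ _ measurePreserving_shear (zak g)) := by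
  set L := (phaseMul (μ := torus2) (fun ξ => (1 / 2) * ξ.2 ^ 2) (by fun_prop)).comp
    (Lp.compMeasurePreservingₗᵢ ℂ _ measurePreserving_shear) with hL
  change _ = L (zak g)
  rw [zak_apply, zak_apply]
  have h := L.toContinuousLinearMap.map_tsum (summable_zakTerm g)
  refine Eq.trans (tsum_congr fun n => ?_) h.symm
  refine Lp.ext ?_
  filter_upwards [coeFn_zakTerm n (chirpL 1 g),
    (quasiMeasurePreserving_sub_snd n).ae (coeFn_chirpL 1 g),
    coeFn_phaseMul (fun ξ : ℝ × ℝ => (1 / 2) * ξ.2 ^ 2) (by fun_prop)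
      (Lp.compMeasurePreservingₗᵢ ℂ _ measurePreserving_shear (zakTerm n g)),
    Lp.coeFn_compMeasurePreserving (zakTerm n g) measurePreserving_shear,
    measurePreserving_shear.quasiMeasurePreserving.ae (coeFn_zakTerm n g)] with ξ h₁ h₂ h₃ h₄ h₅
  rw [h₁, h₂]
  refine Eq.trans ?_ h₃.symm
  refine Eq.trans ?_ (congrArg _ (h₄.trans h₅)).symm
  obtain ⟨k, hk⟩ := exists_toUnitIoc (ξ.1 - ξ.2 + 1 / 2)
  simp only [hk]
  rw [← mul_assoc, ← mul_assoc, ← e_add, ← e_add]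
  congr 1
  -- Evenness of `n(n + 1)` makes `½ n² + ½ n` an integer; together with `n k` from reduction modulo
  -- one, the phases differ by an integer.
  obtain ⟨j, hj⟩ := Int.even_mul_succ_self n
  have hj' : (n : ℝ) * (n + 1) = j + j := by exact_mod_cast hj
  have h6 : (n : ℝ) * ξ.1 + 1 / 2 * 1 * ((n : ℝ) - ξ.2) ^ 2 + ((n * k - j + n : ℤ) : ℝ) =
      1 / 2 * ξ.2 ^ 2 + n * (ξ.1 - ξ.2 + 1 / 2 + k) := by
    push_cast
    linear_combination (1 / 2) * hj'
  refine Eq.trans ?_ (congrArg e h6)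
  rw [e_add _ ((n * k - j + n : ℤ) : ℝ), e_intCast]
  simp only [mul_one]

lemma summable_schwartz_sub (g : 𝓢(ℝ, ℂ)) (y : ℝ) : Summable fun n : ℤ => g (n - y) := by
  have h := summable_of_isBigO (Real.summable_abs_int_rpow one_lt_two)
    ((isBigO_norm_restrict_cocompact ⟨g, g.continuous⟩ two_pos (g.isBigO_cocompact_rpow (-2))
      ⟨{-y}, isCompact_singleton⟩).comp_tendsto Int.tendsto_coe_cofinite)
  refine Summable.of_norm_bounded h fun n => ?_
  have := ContinuousMap.norm_coe_le_norm
    (((⟨g, g.continuous⟩ : C(ℝ, ℂ)).comp (ContinuousMap.addRight (n : ℝ))).restrict {-y})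
    ⟨-y, rfl⟩
  refine le_trans (le_of_eq ?_) this
  simp [sub_eq_add_neg, add_comm]

/-- For Schwartz functions the `L²` sum is also the pointwise sum, which is what Poisson summation
addresses. -/
lemma hasSum_zak_toLp (g : 𝓢(ℝ, ℂ)) :
    ∀ᵐ ξ ∂torus2, HasSum (fun n : ℤ => e (n * ξ.1) * g (n - ξ.2)) (zak (g.toLp 2) ξ) := by
  have h1 : HasSum (fun n => zakTerm n (g.toLp 2)) (zak (g.toLp 2)) :=
    (summable_zakTerm _).hasSum
  -- Convergence in `L²` yields almost everywhere convergence only along some sequence of finite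
  -- sets; absolute summability at each point identifies the limit.
  obtain ⟨s, hs, hsae⟩ := (tendstoInMeasure_of_tendsto_Lp h1).exists_seq_tendsto_ae'
  have h2 : ∀ᵐ ξ ∂torus2, ∀ n : ℤ, zakTerm n (g.toLp 2) ξ = e (n * ξ.1) * g (n - ξ.2) := by
    refine ae_all_iff.2 fun n => ?_
    filter_upwards [coeFn_zakTerm n (g.toLp 2),
      (quasiMeasurePreserving_sub_snd n).ae (g.coeFn_toLp 2 volume)] with ξ h₁ h₂
    rw [h₁, h₂]
  have h3 : ∀ᵐ ξ ∂torus2, ∀ i : ℕ, (∑ n ∈ s i, zakTerm n (g.toLp 2) : Lp ℂ 2 torus2) ξ =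
      ∑ n ∈ s i, zakTerm n (g.toLp 2) ξ := by
    refine ae_all_iff.2 fun i => ?_
    filter_upwards [Lp.coeFn_finsetSum (s i) fun n => zakTerm n (g.toLp 2)] with ξ h
    rw [h, Finset.sum_apply]
  filter_upwards [hsae, h2, h3] with ξ h₁ h₂ h₃
  have hsum : Summable fun n : ℤ => e (n * ξ.1) * g (n - ξ.2) := by
    refine Summable.of_norm ?_
    simpa [norm_e] using (summable_schwartz_sub g ξ.2).norm
  have h4 := hsum.hasSum.comp hs
  simp only [h₃, h₂] at h₁
  rw [tendsto_nhds_unique h₁ h4]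
  exact hsum.hasSum

/-- Poisson summation for `t ↦ e(t x) g(t)` at `-y`. -/
lemma tsum_zak_poisson (g : 𝓢(ℝ, ℂ)) (x y : ℝ) : ∑' n : ℤ, e (n * x) * g (n - y) =
    e (x * y) * ∑' n : ℤ, e (n * (1 - y)) * 𝓕 g (n - x) := by
  set k : ℝ → ℂ := fun t => e (t * x) * g t with hk
  have hkc : Continuous k := (continuous_e.comp (by fun_prop)).mul g.continuous
  have hkO : k =O[cocompact ℝ] fun t : ℝ => |t| ^ (-2 : ℝ) := by
    refine (Asymptotics.isBigO_of_le _ fun t => ?_).trans (g.isBigO_cocompact_rpow (-2))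
    simp [hk, norm_e]
  have hF : ∀ n : ℤ, 𝓕 k n = 𝓕 g (n - x) := fun n => by
    rw [SchwartzMap.fourier_coe, Real.fourier_eq', Real.fourier_eq']
    congr 1
    funext t
    simp only [smul_eq_mul, hk]
    rw [← mul_assoc, e_eq_cexp, ← Complex.exp_add]
    congr 2
    simp
    ring
  have hs : Summable fun n : ℤ => 𝓕 k n := by
    simp only [hF]
    exact summable_schwartz_sub (𝓕 g) x
  have h := Real.tsum_eq_tsum_fourier_of_rpow_decay_of_summable hkc one_lt_two hkO hs (-y)
  have h1 : ∀ n : ℤ, e (n * x) * g (n - y) = e (x * y) * k (-y + n) := fun n => by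
    simp only [hk]
    rw [← mul_assoc, ← e_add, show -y + (n : ℝ) = n - y by ring]
    congr 2
    ring
  simp only [h1]
  rw [tsum_mul_left, h]
  congr 1
  refine tsum_congr fun n => ?_
  rw [hF, mul_comm]
  congr 1
  -- Since `e(n) = 1`, the factor `e(-n y)` may be written `e(n(1 - y))`, so that the quarter turn
  -- keeps to the unit square.
  rw [fourier_coe_apply, mul_sub, mul_one, sub_eq_add_neg, e_add, e_intCast, one_mul, e_eq_cexp]
  congr 1
  push_cast
  ring

lemma zak_eq_zak_fourierL (g : L2R) : zak g = phaseMul (fun ξ => ξ.1 * ξ.2) (by fun_prop)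
    (Lp.compMeasurePreservingₗᵢ ℂ _ measurePreserving_quarterTurn (zak (fourierL g))) := by
  refine schwartz_induction (p := fun g => zak g = phaseMul (fun ξ => ξ.1 * ξ.2) (by fun_prop)
    (Lp.compMeasurePreservingₗᵢ ℂ _ measurePreserving_quarterTurn (zak (fourierL g))))
    (isClosed_eq (by fun_prop) (by fun_prop)) (fun g => ?_) g
  refine Lp.ext ?_
  rw [fourierL_toLp]
  filter_upwards [hasSum_zak_toLp g,
    coeFn_phaseMul (fun ξ : ℝ × ℝ => ξ.1 * ξ.2) (by fun_prop)
      (Lp.compMeasurePreservingₗᵢ ℂ _ measurePreserving_quarterTurn (zak ((𝓕 g).toLp 2))),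
    Lp.coeFn_compMeasurePreserving (zak ((𝓕 g).toLp 2)) measurePreserving_quarterTurn,
    measurePreserving_quarterTurn.quasiMeasurePreserving.ae (hasSum_zak_toLp (𝓕 g))]
    with ξ h₁ h₂ h₃ h₄
  rw [← h₁.tsum_eq]
  refine Eq.trans ?_ h₂.symm
  refine Eq.trans ?_ (congrArg _ (h₃.trans h₄.tsum_eq.symm)).symm
  exact tsum_zak_poisson g ξ.1 ξ.2


/-! ### Torus averages: invariance and continuity -/

instance : IsProbabilityMeasure torus2 := by
  unfold torus2
  infer_instance

instance : IsProbabilityMeasure torus3 := by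
  unfold torus3
  infer_instance

/-- The average of `F (e(t) |H(ξ)|)` over `𝕋³`. -/
def torusAverage (F : ℂ → ℝ) (H : Lp ℂ 2 torus2) : ℝ :=
  ∫ p, F (e p.1 * (‖H p.2‖ : ℝ)) ∂torus3

lemma stronglyMeasurable_integrand {F : ℂ → ℝ} (hF : Continuous F) (H : Lp ℂ 2 torus2) :
    StronglyMeasurable fun p : ℝ × (ℝ × ℝ) => F (e p.1 * (‖H p.2‖ : ℝ)) := by
  refine hF.comp_stronglyMeasurable (StronglyMeasurable.mul ?_ ?_)
  · exact (continuous_e.comp continuous_fst).stronglyMeasurable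
  · exact Complex.continuous_ofReal.comp_stronglyMeasurable
      ((Lp.stronglyMeasurable H).comp_measurable measurable_snd).norm

/-- The average depends only on the distribution of `‖H‖`, so unimodular factors and
measure-preserving substitutions leave it unchanged. -/
lemma torusAverage_eq_of_measurePreserving {F : ℂ → ℝ} (hF : Continuous F) {σ : ℝ × ℝ → ℝ × ℝ}
    (hσ : MeasurePreserving σ torus2 torus2) {H₁ H₂ : Lp ℂ 2 torus2}
    (h : ∀ᵐ ξ ∂torus2, ‖H₁ ξ‖ = ‖H₂ (σ ξ)‖) : torusAverage F H₁ = torusAverage F H₂ := by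
  have hm : MeasurePreserving (Prod.map id σ : ℝ × (ℝ × ℝ) → ℝ × (ℝ × ℝ)) torus3 torus3 :=
    (MeasurePreserving.id torus1).prod hσ
  have h1 := integral_map (φ := (Prod.map id σ : ℝ × (ℝ × ℝ) → ℝ × (ℝ × ℝ))) (μ := torus3)
    hm.measurable.aemeasurable
    (stronglyMeasurable_integrand hF H₂).aestronglyMeasurable
  rw [hm.map_eq] at h1
  rw [torusAverage, torusAverage, h1]
  refine integral_congr_ae ?_
  have h2 : ∀ᵐ p ∂torus3, ‖H₁ p.2‖ = ‖H₂ (σ p.2)‖ :=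
    (Measure.quasiMeasurePreserving_snd (μ := torus1) (ν := torus2)).ae h
  filter_upwards [h2] with p hp
  rw [hp]
  rfl

lemma norm_phaseMul_comp (g : ℝ × ℝ → ℝ) (hg : Continuous g) {σ : ℝ × ℝ → ℝ × ℝ}
    (hσ : MeasurePreserving σ torus2 torus2) (H : Lp ℂ 2 torus2) :
    ∀ᵐ ξ ∂torus2, ‖phaseMul g hg (Lp.compMeasurePreservingₗᵢ ℂ σ hσ H) ξ‖ = ‖H (σ ξ)‖ := by
  filter_upwards [coeFn_phaseMul g hg (Lp.compMeasurePreservingₗᵢ ℂ σ hσ H),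
    Lp.coeFn_compMeasurePreserving H hσ] with ξ h₁ h₂
  rw [h₁, norm_mul, norm_e, one_mul]
  exact congrArg norm h₂

lemma torusAverage_smul {F : ℂ → ℝ} (hF : Continuous F) {z : ℂ} (hz : ‖z‖ = 1)
    (H : Lp ℂ 2 torus2) : torusAverage F (z • H) = torusAverage F H := by
  refine torusAverage_eq_of_measurePreserving hF (MeasurePreserving.id torus2) ?_
  filter_upwards [Lp.coeFn_smul z H] with ξ h
  rw [h, Pi.smul_apply, norm_smul, hz, one_mul]
  rfl

/-- Every subsequence of an `L²`-convergent sequence has a further subsequence converging almost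
everywhere, along which bounded convergence applies; this suffices for convergence of the whole
sequence. -/
lemma continuous_torusAverage {F : ℂ → ℝ} (hF : Continuous F) {C : ℝ} (hC : ∀ z, |F z| ≤ C) :
    Continuous (torusAverage F) := by
  refine continuous_iff_continuousAt.2 fun H => tendsto_iff_seq_tendsto.2 fun u hu => ?_
  refine tendsto_of_subseq_tendsto fun ns hns => ?_
  obtain ⟨ms, -, hms⟩ := (tendstoInMeasure_of_tendsto_Lp (hu.comp hns)).exists_seq_tendsto_ae
  refine ⟨ms, ?_⟩
  refine tendsto_integral_of_dominated_convergence (fun _ => C)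
    (fun i => (stronglyMeasurable_integrand hF _).aestronglyMeasurable) (integrable_const C)
    (fun i => Eventually.of_forall fun p => hC _) ?_
  have h2 : ∀ᵐ p ∂torus3, Tendsto (fun i => (u (ns (ms i)) : ℝ × ℝ → ℂ) p.2) atTop (𝓝 (H p.2)) :=
    (Measure.quasiMeasurePreserving_snd (μ := torus1) (ν := torus2)).ae hms
  filter_upwards [h2] with p hp
  exact (hF.tendsto _).comp
    (tendsto_const_nhds.mul ((Complex.continuous_ofReal.tendsto _).comp hp.norm))

lemma nu_eq_torusAverage (f : L2R) (F : ℂ → ℝ) (M : SL(2, ℝ)) :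
    nu f F M = torusAverage F (zak (metaOp M f)) := by
  rw [nu, torusAverage, Theta_eq_zak, metaOp]

lemma nu_TR_mul (f : L2R) {F : ℂ → ℝ} (hF : Continuous F) (M : SL(2, ℝ)) :
    nu f F (TR * M) = nu f F M := by
  rw [nu_eq_torusAverage, nu_eq_torusAverage, metaOp_TR_mul, zak_chirpL_one]
  exact torusAverage_eq_of_measurePreserving hF measurePreserving_shear (norm_phaseMul_comp _ _ _ _)

lemma nu_SR_mul (f : L2R) {F : ℂ → ℝ} (hF : Continuous F) (M : SL(2, ℝ)) :
    nu f F (SR * M) = nu f F M := by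
  obtain ⟨z, hz, h⟩ := fourierL_metaOp M f
  rw [nu_eq_torusAverage, nu_eq_torusAverage, zak_eq_zak_fourierL (metaOp M f), h, map_smul,
    ← torusAverage_smul hF hz]
  exact (torusAverage_eq_of_measurePreserving hF measurePreserving_quarterTurn
    (norm_phaseMul_comp _ _ _ _)).symm

lemma nu_mul_of_mem (f : L2R) {F : ℂ → ℝ} (hF : Continuous F) {γ : SL(2, ℝ)} (hγ : γ ∈ Gam)
    (M : SL(2, ℝ)) : nu f F (γ * M) = nu f F M := by
  obtain ⟨g, rfl⟩ := hγ
  have hg : g ∈ Subgroup.closure {ModularGroup.S, ModularGroup.T} := by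
    rw [SpecialLinearGroup.SL2Z_generators]
    trivial
  induction hg using Subgroup.closure_induction generalizing M with
  | mem x hx =>
    rcases hx with rfl | rfl
    · exact nu_SR_mul f hF M
    · exact nu_TR_mul f hF M
  | one => rw [map_one, one_mul]
  | mul x y _ _ hx hy => rw [map_mul, mul_assoc, hx, hy]
  | inv x _ hx => rw [← hx, ← mul_assoc, ← map_mul, mul_inv_cancel, map_one, one_mul]

lemma continuousAt_nu_of_ne_zero (f : L2R) {F : ℂ → ℝ} (hF : Continuous F) {C : ℝ}
    (hC : ∀ z, |F z| ≤ C) {M : SL(2, ℝ)} (hM : M 1 0 ≠ 0) : ContinuousAt (nu f F) M := by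
  have hent : Continuous fun M : SL(2, ℝ) => M 1 0 :=
    Continuous.matrix_elem continuous_subtype_val 1 0
  have hopen : IsOpen {M : SL(2, ℝ) | M 1 0 ≠ 0} := isOpen_ne_fun hent continuous_const
  have h : Continuous fun M : {M : SL(2, ℝ) // M 1 0 ≠ 0} => nu f F M := by
    simp only [nu_eq_torusAverage]
    exact (continuous_torusAverage hF hC).comp (zak.continuous.comp (continuous_metaOp f))
  exact (hopen.isOpenEmbedding_subtypeVal.continuousAt_iff (x := ⟨M, hM⟩)).1 h.continuousAt

lemma continuous_nu (f : L2R) {F : ℂ → ℝ} (hF : Continuous F) {C : ℝ} (hC : ∀ z, |F z| ≤ C) :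
    Continuous (nu f F) := by
  refine continuous_iff_continuousAt.2 fun M => ?_
  by_cases hM : M 1 0 = 0
  · have hdet := det_eq M
    rw [hM, mul_zero, sub_zero] at hdet
    -- The lower-left entry of `SR * M` is `M 0 0`, which is invertible since `M 0 0 * M 1 1 = 1`
    -- here.
    have hS : (SR * M) 1 0 ≠ 0 :=
      (SR_mul_entries M).2.2.1 ▸ left_ne_zero_of_mul_eq_one hdet
    have h := (continuousAt_nu_of_ne_zero f hF hC hS).comp
      (f := fun M => SR * M) (continuous_const_mul SR).continuousAt
    exact h.congr (Eventually.of_forall fun N => nu_SR_mul f hF N)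
  · exact continuousAt_nu_of_ne_zero f hF hC hM

lemma abs_nu_le (f : L2R) {F : ℂ → ℝ} {C : ℝ} (hC : ∀ z, |F z| ≤ C) (M : SL(2, ℝ)) :
    |nu f F M| ≤ C := by
  have := norm_integral_le_of_norm_le_const (μ := torus3)
    (f := fun p : ℝ × (ℝ × ℝ) => F (e p.1 * (‖Theta f (tau M) (phi M) p.2‖ : ℝ)))
    (Eventually.of_forall fun p => hC _)
  simpa [nu] using this

end ThetaSum

end

theorem mainTheorem3 (f : MeasureTheory.Lp ℂ 2 (MeasureTheory.volume : MeasureTheory.Measure ℝ))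
    (F : ℂ → ℝ) (hF : Continuous F) (hFb : ∃ C : ℝ, ∀ z : ℂ, |F z| ≤ C) :
    (∀ (τ : UpperHalfPlane) (φ : ℝ), Summable (ThetaSum.term f τ φ)) ∧
    ∃ ν : BoundedContinuousFunction ThetaSum.Quo ℝ,
      ∀ M : Matrix.SpecialLinearGroup (Fin 2) ℝ,
        ν (Quotient.mk (QuotientGroup.rightRel ThetaSum.Gam) M) = ThetaSum.nu f F M := by
  obtain ⟨C, hC⟩ := hFb
  refine ⟨fun τ φ => ?_, ?_⟩
  · simp only [funext (ThetaSum.term_eq_zakTerm f τ φ)]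
    exact ThetaSum.summable_zakTerm _
  · have hinv : ∀ M N : Matrix.SpecialLinearGroup (Fin 2) ℝ,
        QuotientGroup.rightRel ThetaSum.Gam M N → ThetaSum.nu f F M = ThetaSum.nu f F N := by
      intro M N h
      -- The relation says `N * M⁻¹ ∈ Γ`, and this element carries `M` to `N`.
      have h1 := ThetaSum.nu_mul_of_mem f hF (QuotientGroup.rightRel_apply.1 h) M
      rw [inv_mul_cancel_right] at h1
      exact h1.symm
    refine ⟨BoundedContinuousFunction.ofNormedAddCommGroup
      (Quotient.lift (ThetaSum.nu f F) hinv)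
      ((ThetaSum.continuous_nu f hF hC).quotient_lift hinv) C ?_, fun M => rfl⟩
    intro q
    induction q using Quotient.inductionOn with
    | _ M => exact ThetaSum.abs_nu_le f hC M
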